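/- All graphs are simple graphs on a fixed finite vertex set $V$. A PDAG is a graph whose edges may be directed or undirected and which has no directed cycle; a DAG is a PDAG without undirected edges. In a PDAG $\mathcal G$, write $y\in ch(x,\mathcal G)$ if $x\to y$ and $y\in sib(x,\mathcal G)$ if $x-y$. The skeleton of $\mathcal G$ is obtained by removing all arrowheads, and a v-structure is a triple $x\to z\leftarrow y$ with $x\ne y$ nonadjacent. A vertex set induces a complete subgraph if any two distinct vertices of it are adjacent (so the empty set and singletons do), and an incomplete subgraph otherwise. Two DAGs are Markov equivalent if they have the same d-separation relations. The CPDAG of a DAG $\mathcal G$ is the PDAG with the same skeleton as $\mathcal G$ in which an edge is directed, $x\to y$, if and only if $x\to y$ is in every DAG Markov equivalent to $\mathcal G$. For a CPDAG $\mathcal G^*$, $[\mathcal G^*]$ is the Markov equivalence class it represents, i.e. the set of DAGs with CPDAG $\mathcal G^*$. A direct causal clause (DCC) $\kappa$ over $V$ consists of a tail $\kappa_t\in V$ and a (possibly empty) head set $\kappa_h\subseteq V\setminus\{\kappa_t\}$; it holds for a DAG $\mathcal G$ if $\kappa_h\cap ch(\kappa_t,\mathcal G)\ne\varnothing$. For a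 set $\mathcal K$ of DCCs, $[\mathcal G^*,\mathcal K]$ is the set of DAGs in $[\mathcal G^*]$ for which every clause of $\mathcal K$ holds; $\mathcal K$ is consistent with $\mathcal G^*$ if $[\mathcal G^*,\mathcal K]\neq\varnothing$. In that case, the MPDAG of $[\mathcal G^*,\mathcal K]$ is the PDAG $\mathcal H$ with the same skeleton and v-structures as $\mathcal G^*$ in which $x\to y$ if and only if $x\to y$ in every DAG in $[\mathcal G^*,\mathcal K]$. Let $[\mathcal H]$ be the set of DAGs that contain all directed edges of $\mathcal H$ and have the same skeleton and v-structures as $\mathcal H$; $\mathcal H$ is called fully informative with respect to $\mathcal K$ and $\mathcal G^*$ if $[\mathcal H]=[\mathcal G^*,\mathcal K]$. **Theorem.** Let $\mathcal G^*$ be a CPDAG, $\mathcal K$ a set of DCCs over $V$ consistent with $\mathcal G^*$, and $\mathcal H$ the MPDAG of $[\mathcal G^*,\mathcal K]$. 1. $\mathcal H$ is fully informative with respect to $\mathcal K$ and $\mathcal G^*$ if and only if, for every $\kappa\in\mathcal K$, either $\kappa_h\cap sib(\kappa_t,\mathcal H)$ induces an incomplete subgraph of $\mathcal H$, or $\kappa_h\cap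 ch(\kappa_t,\mathcal H)\neq\varnothing$ (or both). 2. Let $\mathcal K(\mathcal G^*)$ be the set of clauses with tail $\kappa_t$ and head set $\kappa_h\cap sib(\kappa_t,\mathcal G^*)$, for all $\kappa\in\mathcal K$ with $\kappa_h\cap ch(\kappa_t,\mathcal G^*)=\varnothing$, and let $\mathcal K^c$ be the set of those $\kappa\in\mathcal K(\mathcal G^*)$ whose head set $\kappa_h$ induces a complete subgraph of $\mathcal G^*$. Then $[\mathcal H]=[\mathcal G^*,\mathcal K]$ if and only if $\kappa_h\cap ch(\kappa_t,\mathcal H)\neq\varnothing$ for every $\kappa\in\mathcal K^c$. -/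

import Mathlib

/-- A partially directed acyclic graph (PDAG) on the vertex set `V`: a simple graph each of whose
edges is either directed, `dir x y` meaning `x → y`, or undirected, `und x y` meaning `x - y`,
without directed cycles. -/
structure PDAG (V : Type*) where
  dir : V → V → Prop
  und : V → V → Prop
  und_symm : ∀ x y, und x y → und y x
  und_irrefl : ∀ x, ¬ und x x
  dir_not_und : ∀ x y, dir x y → ¬ und x y
  acyclic : ∀ x, ¬ Relation.TransGen dir x x

namespace PDAG

variable {V : Type*}

/-- The children of `x`. -/
def ch (G : PDAG V) (x : V) : Set V := {y | G.dir x y}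

/-- The siblings of `x`. -/
def sib (G : PDAG V) (x : V) : Set V := {y | G.und x y}

/-- The skeleton: the undirected graph obtained by removing all arrowheads. -/
def skeleton (G : PDAG V) : SimpleGraph V where
  Adj x y := G.dir x y ∨ G.dir y x ∨ G.und x y
  symm := ⟨by
    rintro x y (h | h | h)
    · exact Or.inr (Or.inl h)
    · exact Or.inl h
    · exact Or.inr (Or.inr (G.und_symm x y h))⟩
  loopless := ⟨by
    rintro x (h | h | h)
    · exact G.acyclic x (Relation.TransGen.single h)
    · exact G.acyclic x (Relation.TransGen.single h)
    · exact G.und_irrefl x h⟩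

/-- A directed acyclic graph (DAG): a PDAG all of whose edges are directed. -/
def IsDAG (G : PDAG V) : Prop := ∀ x y, ¬ G.und x y

/-- `(x, z, y)` is a v-structure collided on `z`: `x → z ← y` with `x`, `y` distinct and
nonadjacent. -/
def IsVStructure (G : PDAG V) (x z y : V) : Prop :=
  x ≠ y ∧ G.dir x z ∧ G.dir y z ∧ ¬ G.skeleton.Adj x y

/-- `G₁` and `G₂` have the same v-structures. -/
def SameVStructures (G₁ G₂ : PDAG V) : Prop :=
  ∀ x z y, G₁.IsVStructure x z y ↔ G₂.IsVStructure x z y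

/-- The descendants of `x`, including `x` itself. -/
def de (G : PDAG V) (x : V) : Set V := {y | Relation.ReflTransGen G.dir x y}

/-- In a DAG, a path is blocked by `Z` if some intermediate vertex `b` of it, with neighbours `a`
and `c` on the path, is either a collider none of whose descendants lies in `Z`, or a non-collider
that lies in `Z`. -/
def IsBlocked (G : PDAG V) {x y : V} (p : G.skeleton.Walk x y) (Z : Set V) : Prop :=
  ∃ a b c, [a, b, c] <:+: p.support ∧
    ((G.dir a b ∧ G.dir c b ∧ Disjoint (G.de b) Z) ∨ (¬ (G.dir a b ∧ G.dir c b) ∧ b ∈ Z))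

/-- `x` and `y` are d-separated by `Z`: all paths between them are blocked by `Z`. -/
def DSep (G : PDAG V) (x y : V) (Z : Set V) : Prop :=
  ∀ p : G.skeleton.Walk x y, p.IsPath → G.IsBlocked p Z

/-- Markov equivalence (of DAGs): the same d-separation relations. -/
def MarkovEquivalent (G₁ G₂ : PDAG V) : Prop :=
  ∀ (x y : V) (Z : Set V), x ≠ y → x ∉ Z → y ∉ Z → (G₁.DSep x y Z ↔ G₂.DSep x y Z)

/-- `C` is the completed PDAG (CPDAG) of the DAG `G`. -/
def IsCPDAGOf (C G : PDAG V) : Prop :=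
  C.skeleton = G.skeleton ∧
    ∀ x y, C.dir x y ↔ ∀ G' : PDAG V, G'.IsDAG → G'.MarkovEquivalent G → G'.dir x y

/-- `C` is a CPDAG. -/
def IsCPDAG (C : PDAG V) : Prop := ∃ G : PDAG V, G.IsDAG ∧ C.IsCPDAGOf G

/-- The Markov equivalence class `[C]` represented by a CPDAG `C`: the DAGs whose CPDAG is `C`. -/
def markovClass (C : PDAG V) : Set (PDAG V) := {G | G.IsDAG ∧ C.IsCPDAGOf G}

/-- `[H]`: the DAGs which contain all directed edges of `H` and have the same skeleton and the same
v-structures as `H`. -/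
def orientations (H : PDAG V) : Set (PDAG V) :=
  {G | G.IsDAG ∧ (∀ x y, H.dir x y → G.dir x y) ∧ G.skeleton = H.skeleton ∧ G.SameVStructures H}

end PDAG

/-- A direct causal clause (DCC) over `V`: `tail` is a direct cause of at least one element of
`heads`. The head set may be empty. -/
structure DCC (V : Type*) where
  tail : V
  heads : Set V
  tail_notMem : tail ∉ heads

namespace DCC

variable {V : Type*}

/-- The DCC `κ` holds for the DAG `G`. -/
def HoldsFor (κ : DCC V) (G : PDAG V) : Prop := (κ.heads ∩ G.ch κ.tail).Nonempty

/-- The DCC with the same tail as `κ` and with head set `κ.heads ∩ S`. -/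
def restrictHeads (κ : DCC V) (S : Set V) : DCC V where
  tail := κ.tail
  heads := κ.heads ∩ S
  tail_notMem h := κ.tail_notMem h.1

end DCC

namespace PDAG

variable {V : Type*}

/-- The restricted Markov equivalence class `[C, K]`. -/
def restrictedClass (C : PDAG V) (K : Set (DCC V)) : Set (PDAG V) :=
  {G | G ∈ C.markovClass ∧ ∀ κ ∈ K, κ.HoldsFor G}

/-- The DCC set `K` is consistent with `C`. -/
def Consistent (C : PDAG V) (K : Set (DCC V)) : Prop := (C.restrictedClass K).Nonempty

/-- `H` is the MPDAG of the (nonempty) restricted Markov equivalence class `[C, K]`. -/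
def IsMPDAGOf (H C : PDAG V) (K : Set (DCC V)) : Prop :=
  H.skeleton = C.skeleton ∧ H.SameVStructures C ∧
    ∀ x y, H.dir x y ↔ ∀ G ∈ C.restrictedClass K, G.dir x y

/-- `H` is fully informative with respect to `K` and `C`. -/
def FullyInformative (H C : PDAG V) (K : Set (DCC V)) : Prop :=
  H.orientations = C.restrictedClass K

/-- The reduced form `K(C)` of `K` with respect to the CPDAG `C`. -/
def reducedForm (C : PDAG V) (K : Set (DCC V)) : Set (DCC V) :=
  {κ' | ∃ κ ∈ K, κ.heads ∩ C.ch κ.tail = ∅ ∧ κ' = κ.restrictHeads (C.sib κ.tail)}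

/-- The clauses of the reduced form whose head set induces a complete subgraph of `C`. (The
undirected subgraph of `C` has the same vertices as `C`, so restricting the reduced form to clauses
over that subgraph drops nothing.) -/
def completeReducedForm (C : PDAG V) (K : Set (DCC V)) : Set (DCC V) :=
  {κ | κ ∈ C.reducedForm K ∧ C.skeleton.IsClique κ.heads}

end PDAG

/-! ### Basic properties of PDAGs and DAGs. -/

namespace PDAG

variable {V : Type*}

/-! By the Verma–Pearl criterion (`markovEquivalent_of_sameVStructures`,
`MarkovEquivalent.skeleton_eq`, `MarkovEquivalent.sameVStructures`), the class of a CPDAG consists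
of the DAGs with its skeleton and v-structures. Hence every member of `[H]` lies in that class, and
`H` is fully informative exactly when every clause holds throughout `[H]`.

Sufficiency is direct. A child of the tail in `H` stays a child. If a clause has two nonadjacent
sibling heads, they cannot both point into the tail without a new v-structure
(`holdsFor_of_not_isClique`).

For necessity, suppose that the sibling heads `M` of the tail `t` form a clique and no head is a
child of `t` in `H`. `exists_forall_dir` provides a DAG in `[H]` in which all of `M` points into
`t`; the clause fails there. The difficulty is that the directed edges of `H` are only known as
those shared by a family of Markov equivalent DAGs. Meek's first three rules split the common
skeleton into compelled and free edges. A compelled edge into one vertex of a free component goes to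
all of it (`Compelled.of_free`), so a component may be reoriented by itself if no v-structure
arises. Inside it the graph is chordal, and a suitable order is built from the back by removing
potential sinks outside `M` (`exists_potentialSink_notMem`), so that `M` precedes `t`.

The second criterion follows by comparing children and siblings in `C` and `H`. -/

theorem IsDAG.adj_iff {G : PDAG V} (hG : G.IsDAG) {x y : V} :
    G.skeleton.Adj x y ↔ G.dir x y ∨ G.dir y x := by
  constructor
  · rintro (h | h | h)
    · exact Or.inl h
    · exact Or.inr h
    · exact absurd h (hG x y)
  · rintro (h | h)
    · exact Or.inl h
    · exact Or.inr (Or.inl h)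

theorem adj_of_dir {G : PDAG V} {x y : V} (h : G.dir x y) : G.skeleton.Adj x y := Or.inl h

theorem dir_asymm {G : PDAG V} {x y : V} (h : G.dir x y) : ¬ G.dir y x := fun h' =>
  G.acyclic x ((Relation.TransGen.single h).tail h')

theorem dir_irrefl (G : PDAG V) (x : V) : ¬ G.dir x x := fun h =>
  G.acyclic x (Relation.TransGen.single h)

theorem ne_of_dir {G : PDAG V} {x y : V} (h : G.dir x y) : x ≠ y := by
  rintro rfl
  exact G.dir_irrefl x h

theorem IsDAG.dir_trans {G : PDAG V} (hG : G.IsDAG) {x y z : V} (hxy : G.dir x y)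
    (hyz : G.dir y z) (hxz : G.skeleton.Adj x z) : G.dir x z := by
  rcases hG.adj_iff.1 hxz with h | h
  · exact h
  · exact absurd (((Relation.TransGen.single hxy).tail hyz).tail h) (G.acyclic x)

/-- A topological numbering of the vertices of a PDAG. -/
theorem exists_topological [Finite V] (G : PDAG V) :
    ∃ f : V → ℕ, ∀ x y, G.dir x y → f x < f y := by
  refine ⟨fun x => {z | Relation.TransGen G.dir z x}.ncard, fun x y h => ?_⟩
  apply Set.ncard_lt_ncard _ (Set.toFinite _)
  refine ⟨fun z hz => Relation.TransGen.tail hz h, fun hsub => ?_⟩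
  exact G.acyclic x (hsub (Relation.TransGen.single h))

theorem IsVStructure.symm {G : PDAG V} {x z y : V} (h : G.IsVStructure x z y) :
    G.IsVStructure y z x :=
  ⟨h.1.symm, h.2.2.1, h.2.1, fun h' => h.2.2.2 h'.symm⟩

theorem SameVStructures.symm {G₁ G₂ : PDAG V} (h : G₁.SameVStructures G₂) :
    G₂.SameVStructures G₁ := fun x z y => (h x z y).symm

theorem SameVStructures.trans {G₁ G₂ G₃ : PDAG V} (h : G₁.SameVStructures G₂)
    (h' : G₂.SameVStructures G₃) : G₁.SameVStructures G₃ :=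
  fun x z y => (h x z y).trans (h' x z y)

/-! ### Active trails -/

/-- The consecutive vertices `a`, `b`, `c` do not block a trail, where the colliders in `S` are open
and the non-colliders in `Z` are closed. -/
def Open (G : PDAG V) (S Z : Set V) (a b c : V) : Prop :=
  (G.dir a b ∧ G.dir c b ∧ b ∈ S) ∨ (¬ (G.dir a b ∧ G.dir c b) ∧ b ∉ Z)

theorem Open.symm {G : PDAG V} {S Z : Set V} {a b c : V} (h : G.Open S Z a b c) :
    G.Open S Z c b a := by
  unfold Open at *
  tauto

/-- A list of successively adjacent vertices all of whose intermediate vertices are open. -/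
def Active (G : PDAG V) (S Z : Set V) (l : List V) : Prop :=
  l.IsChain G.skeleton.Adj ∧ ∀ a b c, [a, b, c] <:+: l → G.Open S Z a b c

theorem Active.of_infix {G : PDAG V} {S Z : Set V} {l l' : List V} (h : G.Active S Z l)
    (hl : l' <:+: l) : G.Active S Z l' :=
  ⟨h.1.infix hl, fun a b c habc => h.2 a b c (habc.trans hl)⟩

theorem active_singleton (G : PDAG V) (S Z : Set V) (a : V) : G.Active S Z [a] := by
  refine ⟨List.isChain_singleton a, fun b c d h => ?_⟩
  have := h.length_le
  simp at this

theorem active_pair {G : PDAG V} {S Z : Set V} {a b : V} :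
    G.Active S Z [a, b] ↔ G.skeleton.Adj a b := by
  refine ⟨fun h => by simpa using h.1, fun h => ⟨by simpa using h, fun c d e h' => ?_⟩⟩
  have := h'.length_le
  simp at this

theorem active_cons_cons_cons {G : PDAG V} {S Z : Set V} {a b c : V} {l : List V} :
    G.Active S Z (a :: b :: c :: l) ↔
      G.skeleton.Adj a b ∧ G.Open S Z a b c ∧ G.Active S Z (b :: c :: l) := by
  constructor
  · intro h
    exact ⟨(List.isChain_cons_cons.1 h.1).1, h.2 a b c ⟨[], l, rfl⟩,
      h.of_infix (List.suffix_cons _ _).isInfix⟩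
  · rintro ⟨hab, ho, h⟩
    refine ⟨List.isChain_cons_cons.2 ⟨hab, h.1⟩, fun a' b' c' h' => ?_⟩
    rcases List.infix_cons_iff.1 h' with h' | h'
    · obtain ⟨t, ht⟩ := h'
      simp only [List.cons_append, List.cons.injEq] at ht
      obtain ⟨rfl, rfl, rfl, -⟩ := ht
      exact ho
    · exact h.2 a' b' c' h'

theorem Active.reverse {G : PDAG V} {S Z : Set V} {l : List V} (h : G.Active S Z l) :
    G.Active S Z l.reverse := by
  refine ⟨?_, fun a b c h' => ?_⟩
  · rw [List.isChain_reverse]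
    exact h.1.imp fun a b hab => hab.symm
  · refine (h.2 c b a ?_).symm
    rw [← List.reverse_infix]
    simpa using h'

/-- Openness is a condition on consecutive triples, and the only triple not contained in one of the
two pieces is the one centred at `v`. -/
theorem Active.splice {G : PDAG V} {S Z : Set V} {v : V} {l₂ : List V} :
    ∀ {l₁ : List V}, G.Active S Z (l₁ ++ [v]) → G.Active S Z (v :: l₂) →
      (∀ a d, l₁.getLast? = some a → l₂.head? = some d → G.Open S Z a v d) →
      G.Active S Z (l₁ ++ v :: l₂)
  | [], _, h₂, _ => h₂
  | [a], h₁, h₂, h => by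
    have hav := active_pair.1 h₁
    cases l₂ with
    | nil => exact h₁
    | cons d l => exact active_cons_cons_cons.2 ⟨hav, h a d rfl rfl, h₂⟩
  | a :: b :: [], h₁, h₂, h => by
    obtain ⟨hab, ho, h₁'⟩ := active_cons_cons_cons.1 h₁
    exact active_cons_cons_cons.2 ⟨hab, ho, Active.splice (l₁ := [b]) h₁' h₂ h⟩
  | a :: b :: c :: l₁, h₁, h₂, h => by
    obtain ⟨hab, ho, h₁'⟩ := active_cons_cons_cons.1 h₁
    refine active_cons_cons_cons.2 ⟨hab, ho, Active.splice (l₁ := b :: c :: l₁) h₁' h₂ ?_⟩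
    intro a' d' ha'
    exact h a' d' (by simpa using ha')

/-- The vertices with a descendant in `W`. -/
def an (G : PDAG V) (W : Set V) : Set V := {b | ¬ Disjoint (G.de b) W}

theorem mem_an {G : PDAG V} {W : Set V} {b : V} :
    b ∈ G.an W ↔ ∃ w ∈ W, Relation.ReflTransGen G.dir b w := by
  simp only [an, Set.mem_ofPred_eq, Set.not_disjoint_iff, de]
  exact ⟨fun ⟨w, h, h'⟩ => ⟨w, h', h⟩, fun ⟨w, h, h'⟩ => ⟨w, h', h⟩⟩

theorem subset_an (G : PDAG V) (W : Set V) : W ⊆ G.an W := fun w hw =>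
  mem_an.2 ⟨w, hw, Relation.ReflTransGen.refl⟩

theorem an_mono (G : PDAG V) {W W' : Set V} (h : W ⊆ W') : G.an W ⊆ G.an W' := fun b hb => by
  obtain ⟨w, hw, hb⟩ := mem_an.1 hb
  exact mem_an.2 ⟨w, h hw, hb⟩

theorem mem_an_of_dir {G : PDAG V} {W : Set V} {a b : V} (h : G.dir a b) (hb : b ∈ G.an W) :
    a ∈ G.an W := by
  obtain ⟨w, hw, hb⟩ := mem_an.1 hb
  exact mem_an.2 ⟨w, hw, hb.head h⟩

theorem exists_walk_of_isChain {A : SimpleGraph V} {y : V} :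
    ∀ (x : V) (l : List V), (x :: l).IsChain A.Adj → (x :: l).getLast? = some y →
      ∃ p : A.Walk x y, p.support = x :: l
  | x, [], _, hy => by
    obtain rfl : x = y := by simpa using hy
    exact ⟨SimpleGraph.Walk.nil, rfl⟩
  | x, z :: l, h, hy => by
    obtain ⟨p, hp⟩ := exists_walk_of_isChain z l (List.isChain_cons_cons.1 h).2 (by simpa using hy)
    exact ⟨SimpleGraph.Walk.cons (List.isChain_cons_cons.1 h).1 p, by simp [hp]⟩

/-- In a DAG, `d`-connection is the existence of an active list without repetitions. -/
theorem not_dSep_iff_exists_active {G : PDAG V} {x y : V} {Z : Set V} :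
    ¬ G.DSep x y Z ↔ ∃ l : List V, (x :: l).getLast? = some y ∧ (x :: l).Nodup ∧
      G.Active (G.an Z) Z (x :: l) := by
  have key : ∀ p : G.skeleton.Walk x y,
      ¬ G.IsBlocked p Z ↔ G.Active (G.an Z) Z p.support := by
    intro p
    simp only [IsBlocked, Active, p.isChain_adj_support, true_and, not_exists, not_and]
    refine forall₃_congr fun a b c => ?_
    simp only [Open, an, Set.mem_ofPred_eq]
    tauto
  simp only [DSep, not_forall]
  constructor
  · rintro ⟨p, hp, hb⟩
    rw [key] at hb
    have hs : p.support = x :: p.support.tail := p.cons_tail_support.symm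
    refine ⟨p.support.tail, ?_, ?_, ?_⟩
    · rw [← hs, List.getLast?_eq_some_getLast p.support_ne_nil]
      simp
    · rw [← hs]
      exact hp.support_nodup
    · rwa [← hs]
  · rintro ⟨l, hl, hn, ha⟩
    obtain ⟨p, hp⟩ := exists_walk_of_isChain x l ha.1 hl
    refine ⟨p, ?_, ?_⟩
    · rw [SimpleGraph.Walk.isPath_def, hp]
      exact hn
    · rw [key, hp]
      exact ha

/-- A directed start of an active list continues up to its end or to an ancestor of `Z`. -/
theorem Active.transGen_or_mem_an {G : PDAG V} (hG : G.IsDAG) {Z : Set V} {w : V} :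
    ∀ {l : List V} {v b : V}, G.Active (G.an Z) Z (v :: b :: l) → G.dir v b →
      (b :: l).getLast? = some w → Relation.TransGen G.dir v w ∨ v ∈ G.an Z
  | [], v, b, _, hvb, hw => by
    obtain rfl : b = w := by simpa using hw
    exact Or.inl (Relation.TransGen.single hvb)
  | c :: l, v, b, h, hvb, hw => by
    obtain ⟨-, ho, h'⟩ := active_cons_cons_cons.1 h
    rcases hG.adj_iff.1 (List.isChain_cons_cons.1 h'.1).1 with hbc | hcb
    · rcases Active.transGen_or_mem_an hG h' hbc (by simpa using hw) with h₁ | h₁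
      · exact Or.inl (h₁.head hvb)
      · exact Or.inr (mem_an_of_dir hvb h₁)
    · rcases ho with ho | ho
      · exact Or.inr (mem_an_of_dir hvb ho.2.2)
      · exact absurd ⟨hvb, hcb⟩ ho.1

theorem exists_eq_append_of_not_nodup {α : Type*} :
    ∀ {l : List α}, ¬ l.Nodup → ∃ v l₁ l₂ l₃, l = l₁ ++ v :: (l₂ ++ v :: l₃)
  | [], h => absurd List.nodup_nil h
  | a :: l, h => by
    by_cases ha : a ∈ l
    · obtain ⟨s, t, rfl⟩ := List.append_of_mem ha
      exact ⟨a, [], s, t, rfl⟩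
    · obtain ⟨v, l₁, l₂, l₃, rfl⟩ :=
        exists_eq_append_of_not_nodup fun h' : l.Nodup => h (List.nodup_cons.2 ⟨ha, h'⟩)
      exact ⟨v, a :: l₁, l₂, l₃, rfl⟩

/-- Cutting out a closed part of an active list leaves an active list. -/
theorem Active.cut {G : PDAG V} (hG : G.IsDAG) {Z : Set V} {v : V} {l₁ l₂ l₃ : List V}
    (h : G.Active (G.an Z) Z (l₁ ++ v :: (l₂ ++ v :: l₃))) :
    G.Active (G.an Z) Z (l₁ ++ v :: l₃) := by
  refine Active.splice (h.of_infix ⟨[], l₂ ++ v :: l₃, by simp⟩)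
    (h.of_infix ⟨l₁ ++ v :: l₂, [], by simp⟩) fun a d ha hd => ?_
  obtain ⟨l₁', rfl⟩ := List.getLast?_eq_some_iff.1 ha
  obtain ⟨l₃', rfl⟩ := List.head?_eq_some_iff.1 hd
  obtain ⟨b, m, hb⟩ : ∃ b m, l₂ ++ [v] = b :: m := by
    cases l₂ with
    | nil => exact ⟨v, [], rfl⟩
    | cons b m => exact ⟨b, m ++ [v], rfl⟩
  obtain ⟨b', m', hb'⟩ : ∃ b' m', v :: l₂ = m' ++ [b'] :=
    ⟨_, _, (List.dropLast_append_getLast (List.cons_ne_nil v l₂)).symm⟩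
  have h₁ : G.Open (G.an Z) Z a v b := by
    refine h.2 a v b ⟨l₁', m ++ d :: l₃', ?_⟩
    have : l₂ ++ v :: d :: l₃' = (l₂ ++ [v]) ++ d :: l₃' := by simp
    rw [this, hb]
    simp
  have h₂ : G.Open (G.an Z) Z b' v d := by
    refine h.2 b' v d ⟨l₁' ++ a :: m', l₃', ?_⟩
    have : l₁' ++ [a] ++ v :: (l₂ ++ v :: d :: l₃') =
        l₁' ++ [a] ++ (v :: l₂) ++ v :: d :: l₃' := by simp
    rw [this, hb']
    simp
  by_cases hc : G.dir a v ∧ G.dir d v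
  · refine Or.inl ⟨hc.1, hc.2, ?_⟩
    rcases h₁ with h₁ | h₁
    · exact h₁.2.2
    -- Here the removed loop leaves `v` along `v → b`. Following it leads either back to `v`, a
    -- directed cycle, or to a collider with a descendant in `Z`.
    · have hloop : G.Active (G.an Z) Z (v :: b :: m) := by
        rw [← hb]
        exact h.of_infix ⟨l₁' ++ [a], d :: l₃', by simp⟩
      have hvb : G.dir v b :=
        (hG.adj_iff.1 (List.isChain_cons_cons.1 hloop.1).1).resolve_right fun h' =>
          h₁.1 ⟨hc.1, h'⟩
      rcases hloop.transGen_or_mem_an hG hvb (w := v) (by rw [← hb]; simp) with h' | h'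
      · exact absurd h' (G.acyclic v)
      · exact h'
  · refine Or.inr ⟨hc, ?_⟩
    -- Since `a → v ← d` fails, `v` was already a non-collider at one of its two occurrences, and so
    -- lies outside `Z`.
    by_cases hav : G.dir a v
    · rcases h₂ with h₂ | h₂
      · exact absurd ⟨hav, h₂.2.1⟩ hc
      · exact h₂.2
    · rcases h₁ with h₁ | h₁
      · exact absurd h₁.1 hav
      · exact h₁.2

theorem Active.exists_nodup {G : PDAG V} (hG : G.IsDAG) {Z : Set V} {x y : V} (n : ℕ) :
    ∀ l : List V, l.length = n → G.Active (G.an Z) Z (x :: l) → (x :: l).getLast? = some y →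
      ∃ l' : List V, (x :: l').getLast? = some y ∧ (x :: l').Nodup ∧
        G.Active (G.an Z) Z (x :: l') := by
  induction n using Nat.strong_induction_on with
  | _ n ih =>
    intro l hn h hy
    by_cases hl : (x :: l).Nodup
    · exact ⟨l, hy, hl, h⟩
    · obtain ⟨v, l₁, l₂, l₃, he⟩ := exists_eq_append_of_not_nodup hl
      have h' := (he ▸ h).cut hG
      have hy' : (l₁ ++ v :: l₃).getLast? = some y := by
        rw [he] at hy
        simpa [List.getLast?_append, List.getLast?_cons] using hy
      have hlen := congrArg List.length he
      obtain ⟨l', hl'⟩ : ∃ l', l₁ ++ v :: l₃ = x :: l' := by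
        cases l₁ with
        | nil =>
          simp only [List.nil_append, List.cons.injEq] at he
          exact ⟨l₃, by simp [he.1]⟩
        | cons a l₁ =>
          simp only [List.cons_append, List.cons.injEq] at he
          exact ⟨l₁ ++ v :: l₃, by simp [he.1]⟩
      have hlen' := congrArg List.length hl'
      simp only [List.length_append, List.length_cons] at hlen hlen'
      exact ih l'.length (by omega) l' rfl (hl' ▸ h') (hl' ▸ hy')

/-! ### Moral graphs -/

/-- Adjacency in the moral graph of the subgraph induced by `U`. -/
def MoralAdj (G : PDAG V) (U : Set V) (a b : V) : Prop :=
  a ≠ b ∧ (G.skeleton.Adj a b ∨ ∃ c ∈ U, G.dir a c ∧ G.dir b c)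

/-- Connection in the moral graph of the subgraph induced by `U` outside `Z`. -/
def MoralConn (G : PDAG V) (U Z : Set V) : V → V → Prop :=
  Relation.ReflTransGen fun a b => (a ∈ U ∧ a ∉ Z) ∧ (b ∈ U ∧ b ∉ Z) ∧ G.MoralAdj U a b

/-- An inner collider is an ancestor of `Z`. From an inner non-collider some edge points out, and
following it in that direction reaches an end or an ancestor of `Z`. -/
theorem Active.mem_an_ends {G : PDAG V} (hG : G.IsDAG) {x y : V} {Z : Set V} {l : List V}
    (h : G.Active (G.an Z) Z l) (hx : l.head? = some x) (hy : l.getLast? = some y) {v : V}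
    (hv : v ∈ l) : v ∈ G.an (insert x (insert y Z)) := by
  have hZ : G.an Z ⊆ G.an (insert x (insert y Z)) :=
    G.an_mono fun z hz => Or.inr (Or.inr hz)
  have hT : ∀ {v w : V}, w ∈ insert x (insert y Z) → Relation.TransGen G.dir v w →
      v ∈ G.an (insert x (insert y Z)) := fun hw h' => mem_an.2 ⟨_, hw, h'.to_reflTransGen⟩
  obtain ⟨s, t, rfl⟩ := List.append_of_mem hv
  rcases List.eq_nil_or_concat s with rfl | ⟨s, a, rfl⟩
  · obtain rfl : v = x := by simpa using hx
    exact G.subset_an _ (Or.inl rfl)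
  cases t with
  | nil =>
    obtain rfl : v = y := by simpa using hy
    exact G.subset_an _ (Or.inr (Or.inl rfl))
  | cons c t =>
    have h₁ : G.Active (G.an Z) Z (v :: c :: t) :=
      h.of_infix (List.suffix_append _ _).isInfix
    have h₂ : G.Active (G.an Z) Z (v :: a :: s.reverse) := by
      have : G.Active (G.an Z) Z (s ++ [a, v]) := h.of_infix ⟨[], c :: t, by simp⟩
      simpa using this.reverse
    rcases h.2 a v c ⟨s, t, by simp⟩ with h' | h'
    · exact hZ h'.2.2
    · by_cases hvc : G.dir v c
      · rcases h₁.transGen_or_mem_an hG hvc (w := y)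
          (by simpa [List.getLast?_append, List.getLast?_cons] using hy) with h'' | h''
        · exact hT (Or.inr (Or.inl rfl)) h''
        · exact hZ h''
      · have hcv := (hG.adj_iff.1 (List.isChain_cons_cons.1 h₁.1).1).resolve_left hvc
        have hva := (hG.adj_iff.1 (List.isChain_cons_cons.1 h₂.1).1).resolve_right
          fun h'' => h'.1 ⟨h'', hcv⟩
        rcases h₂.transGen_or_mem_an hG hva (w := x) (by
          cases s with
          | nil => simpa using hx
          | cons b s => simpa [List.getLast?_cons] using hx) with h'' | h''
        · exact hT (Or.inl rfl) h''
        · exact hZ h''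

/-- A vertex of `Z` on the list must be a collider, so its two neighbours are married in the moral
graph and it can be skipped. -/
theorem Active.moralConn {G : PDAG V} {U Z : Set V} {y : V} (hy : y ∉ Z) :
    ∀ {l : List V} {v : V}, G.Active (G.an Z) Z (v :: l) → (v :: l).getLast? = some y → v ∉ Z →
      (∀ u ∈ v :: l, u ∈ U) → G.MoralConn U Z v y
  | [], v, _, hv, _, _ => by
    obtain rfl : v = y := by simpa using hv
    exact Relation.ReflTransGen.refl
  | [b], v, h, hv, hvZ, hU => by
    obtain rfl : b = y := by simpa using hv
    have hvb := active_pair.1 h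
    exact Relation.ReflTransGen.single
      ⟨⟨hU v (by simp), hvZ⟩, ⟨hU b (by simp), hy⟩, hvb.ne, Or.inl hvb⟩
  | b :: c :: l, v, h, hv, hvZ, hU => by
    obtain ⟨hvb, ho, h'⟩ := active_cons_cons_cons.1 h
    by_cases hb : b ∈ Z
    · obtain ⟨hvb', hcb, -⟩ : G.dir v b ∧ G.dir c b ∧ b ∈ G.an Z :=
        ho.resolve_right fun h => h.2 hb
      -- The edge `c → b` leaves `c`, so `c` is the end or a non-collider.
      have hc : c ∉ Z := by
        cases l with
        | nil =>
          obtain rfl : c = y := by simpa using hv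
          exact hy
        | cons d l =>
          rcases (active_cons_cons_cons.1 h').2.1 with h'' | h''
          · exact absurd h''.1 (dir_asymm hcb)
          · exact h''.2
      have ih := Active.moralConn hy (U := U) (h'.of_infix (List.suffix_cons _ _).isInfix)
        (by simpa using hv) hc fun u hu => hU u (by simp only [List.mem_cons] at hu ⊢; tauto)
      by_cases hvc : v = c
      · rwa [hvc]
      · exact ih.head ⟨⟨hU v (by simp), hvZ⟩, ⟨hU c (by simp), hc⟩, hvc,
          Or.inr ⟨b, hU b (by simp), hvb', hcb⟩⟩
    · have ih := Active.moralConn hy (U := U) h'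
        (by simpa using hv) hb fun u hu => hU u (by simp only [List.mem_cons] at hu ⊢; tauto)
      exact ih.head ⟨⟨hU v (by simp), hvZ⟩, ⟨hU b (by simp), hb⟩, hvb.ne, Or.inl hvb⟩

theorem Active.cons {G : PDAG V} {S Z : Set V} {a v : V} {l : List V}
    (h : G.Active S Z (v :: l)) (hav : G.skeleton.Adj a v) (ho : ∀ d, G.Open S Z a v d) :
    G.Active S Z (a :: v :: l) := by
  cases l with
  | nil => exact active_pair.2 hav
  | cons d l => exact active_cons_cons_cons.2 ⟨hav, ho d, h⟩

theorem open_of_mem_of_notMem {G : PDAG V} {S Z : Set V} {a b c : V} (hS : b ∈ S) (hZ : b ∉ Z) :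
    G.Open S Z a b c := by
  unfold Open
  tauto

theorem open_of_dir {G : PDAG V} {S Z : Set V} {a b c : V} (h : G.dir b a) (hZ : b ∉ Z) :
    G.Open S Z a b c :=
  Or.inr ⟨fun h' => dir_asymm h h'.1, hZ⟩

/-- A marriage edge is replaced by the detour through a common child. All colliders lie in `U`, but
they need not yet be ancestors of `Z`. -/
theorem MoralConn.exists_active {G : PDAG V} {U Z : Set V} {x y : V}
    (h : G.MoralConn U Z x y) :
    ∃ l : List V, (x :: l).getLast? = some y ∧ G.Active U Z (x :: l) := by
  induction h using Relation.ReflTransGen.head_induction_on with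
  | refl => exact ⟨[], rfl, active_singleton _ _ _ _⟩
  | @head a b hab _ ih =>
    obtain ⟨-, ⟨hbU, hbZ⟩, -, hab | ⟨c, hc, hac, hbc⟩⟩ := hab
    · obtain ⟨l, hl, hA⟩ := ih
      exact ⟨b :: l, by simpa using hl, hA.cons hab fun d => open_of_mem_of_notMem hbU hbZ⟩
    · obtain ⟨l, hl, hA⟩ := ih
      exact ⟨c :: b :: l, by simpa using hl, active_cons_cons_cons.2 ⟨adj_of_dir hac,
        Or.inl ⟨hac, hbc, hc⟩, hA.cons (adj_of_dir hbc).symm fun d =>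
          open_of_mem_of_notMem hbU hbZ⟩⟩

/-- The directed path from `b` to `x` is prepended in reverse. Each vertex passed has an edge
pointing out towards `x`, so it is a non-collider, and `b ∉ G.an Z` keeps it outside `Z`. -/
theorem Active.exists_of_reflTransGen {G : PDAG V} {S Z : Set V} {b x y : V}
    (h : Relation.ReflTransGen G.dir b x) :
    b ∉ G.an Z → ∀ l : List V, G.Active S Z (b :: l) → (b :: l).getLast? = some y →
      ∃ l' : List V, (x :: l').getLast? = some y ∧ G.Active S Z (x :: l') := by
  induction h using Relation.ReflTransGen.head_induction_on with
  | refl => exact fun _ l hA hl => ⟨l, hl, hA⟩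
  | @head b b' hb _ ih =>
    intro hbZ l hA hl
    refine ih (fun h => hbZ (mem_an_of_dir hb h)) (b :: l)
      (hA.cons (adj_of_dir hb).symm fun d => open_of_dir hb fun h => hbZ (G.subset_an Z h))
      (by simpa using hl)

/-- Open colliders which are ancestors of the first vertex can be avoided. -/
theorem Active.exists_of_union {G : PDAG V} {S Z : Set V} (hS : G.an Z ⊆ S) {x y : V} (n : ℕ) :
    ∀ (v : V) (l : List V), l.length = n → (v = x ∨ v ∉ G.an Z ∧ v ∈ G.an {x}) →
      G.Active (S ∪ G.an {x}) Z (v :: l) → (v :: l).getLast? = some y →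
      ∃ l' : List V, (x :: l').getLast? = some y ∧ G.Active S Z (x :: l') := by
  induction n using Nat.strong_induction_on with
  | _ n ih =>
    intro v l hn hv hA hl
    by_cases hA' : G.Active S Z (v :: l)
    · rcases hv with rfl | ⟨hvZ, hvx⟩
      · exact ⟨l, hl, hA'⟩
      · obtain ⟨w, rfl, hw⟩ := mem_an.1 hvx
        exact Active.exists_of_reflTransGen hw hvZ l hA' hl
    · simp only [Active, hA.1, true_and, not_forall] at hA'
      obtain ⟨a, b, c, habc, hno⟩ := hA'
      have hb : b ∈ G.an {x} ∧ b ∉ S := by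
        rcases hA.2 a b c habc with h | h
        · have hbS : b ∉ S := fun hb => hno (Or.inl ⟨h.1, h.2.1, hb⟩)
          exact ⟨h.2.2.resolve_left hbS, hbS⟩
        · exact absurd (Or.inr h) hno
      obtain ⟨s, t, he⟩ := habc
      have hlen := congrArg List.length he
      simp only [List.length_append, List.length_cons, List.length_nil] at hlen
      -- Everything before the collider `b` is dropped; a directed path from the final starting
      -- vertex to `x` is prepended only at the end.
      refine ih (c :: t).length (by simp only [List.length_cons]; omega) b (c :: t) rfl
        (Or.inr ⟨fun h => hb.2 (hS h), hb.1⟩) (hA.of_infix ⟨s ++ [a], [], by simp [← he]⟩) ?_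
      rw [← he] at hl
      simpa [List.getLast?_append, List.getLast?_cons] using hl

theorem Active.exists_reverse {G : PDAG V} {S Z : Set V} {x y : V} {l : List V}
    (h : G.Active S Z (x :: l)) (hl : (x :: l).getLast? = some y) :
    ∃ l' : List V, (y :: l').getLast? = some x ∧ G.Active S Z (y :: l') := by
  obtain ⟨m, hm⟩ := List.getLast?_eq_some_iff.1 hl
  have he : (x :: l).reverse = y :: m.reverse := by rw [hm]; simp
  refine ⟨m.reverse, ?_, ?_⟩
  · rw [← he]
    simp
  · rw [← he]
    exact h.reverse

theorem an_insert (G : PDAG V) (x : V) (W : Set V) : G.an (insert x W) = G.an W ∪ G.an {x} := by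
  ext b
  simp only [mem_an, Set.mem_union, Set.mem_insert_iff, Set.mem_singleton_iff]
  constructor
  · rintro ⟨w, rfl | hw, h⟩
    · exact Or.inr ⟨w, rfl, h⟩
    · exact Or.inl ⟨w, hw, h⟩
  · rintro (⟨w, hw, h⟩ | ⟨w, rfl, h⟩)
    · exact ⟨w, Or.inr hw, h⟩
    · exact ⟨w, Or.inl rfl, h⟩

/-- `d`-connection is connection in the moral graph of the ancestral set. -/
theorem IsDAG.not_dSep_iff_moralConn {G : PDAG V} (hG : G.IsDAG) {x y : V} {Z : Set V}
    (hx : x ∉ Z) (hy : y ∉ Z) :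
    ¬ G.DSep x y Z ↔ G.MoralConn (G.an (insert x (insert y Z))) Z x y := by
  rw [not_dSep_iff_exists_active]
  constructor
  · rintro ⟨l, hl, -, hA⟩
    exact hA.moralConn hy hl hx fun u hu => hA.mem_an_ends hG rfl hl hu
  · intro h
    obtain ⟨l, hl, hA⟩ := h.exists_active
    rw [an_insert, an_insert] at hA
    obtain ⟨l₁, hl₁, hA₁⟩ := Active.exists_of_union Set.subset_union_left _ x l rfl
      (Or.inl rfl) hA hl
    obtain ⟨l₂, hl₂, hA₂⟩ := hA₁.exists_reverse hl₁
    obtain ⟨l₃, hl₃, hA₃⟩ := Active.exists_of_union subset_rfl _ y l₂ rfl (Or.inl rfl) hA₂ hl₂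
    obtain ⟨l₄, hl₄, hA₄⟩ := hA₃.exists_reverse hl₃
    exact Active.exists_nodup hG _ l₄ rfl hA₄ hl₄

/-! ### Markov equivalence -/

theorem MoralAdj.congr {G₁ G₂ : PDAG V} (hs : G₁.skeleton = G₂.skeleton)
    (hv : G₁.SameVStructures G₂) {U : Set V} {a b : V} (h : G₁.MoralAdj U a b) :
    G₂.MoralAdj U a b := by
  refine ⟨h.1, ?_⟩
  by_cases hab : G₁.skeleton.Adj a b
  · exact Or.inl (hs ▸ hab)
  · obtain ⟨c, hc, hac, hbc⟩ := h.2.resolve_left hab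
    have := (hv a c b).1 ⟨h.1, hac, hbc, hab⟩
    exact Or.inr ⟨c, hc, this.2.1, this.2.2.1⟩

theorem MoralConn.congr {G₁ G₂ : PDAG V} (hs : G₁.skeleton = G₂.skeleton)
    (hv : G₁.SameVStructures G₂) {U Z : Set V} {x y : V} (h : G₁.MoralConn U Z x y) :
    G₂.MoralConn U Z x y :=
  Relation.ReflTransGen.mono (fun _ _ hab => ⟨hab.1, hab.2.1, hab.2.2.congr hs hv⟩) _ _ h

theorem MoralConn.mono {G : PDAG V} {U U' Z : Set V} (hU : U ⊆ U') {x y : V}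
    (h : G.MoralConn U Z x y) : G.MoralConn U' Z x y :=
  Relation.ReflTransGen.mono (fun _ _ hab => ⟨⟨hU hab.1.1, hab.1.2⟩, ⟨hU hab.2.1.1, hab.2.1.2⟩,
    hab.2.2.1, hab.2.2.2.imp id fun ⟨c, hc, h⟩ => ⟨c, hU hc, h⟩⟩) _ _ h

/-- If `s` is a sink of `G₁` in `U` but not a sink of `G₂` in `U`, then its neighbours in `U` are
adjacent in the moral graph of `U \ {s}`. -/
theorem moralAdj_diff_singleton {G₁ G₂ : PDAG V} (h₁ : G₁.IsDAG) (h₂ : G₂.IsDAG)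
    (hs : G₁.skeleton = G₂.skeleton) (hv : G₁.SameVStructures G₂) {U : Set V} {s c : V}
    (hsink : ∀ u ∈ U, ¬ G₁.dir s u) (hc : c ∈ U) (hsc : G₂.dir s c) {a b : V} (ha : a ∈ U)
    (hb : b ∈ U) (hsa : G₂.skeleton.Adj s a) (hsb : G₂.skeleton.Adj s b) (hab : a ≠ b) :
    G₂.MoralAdj (U \ {s}) a b := by
  -- A child `c` of `s` in `G₂` is adjacent to every other neighbour `a`: otherwise `a → s ← c`
  -- would be a v-structure of `G₁`, hence of `G₂`.
  have key : ∀ c ∈ U, ∀ a ∈ U, G₂.dir s c → G₂.skeleton.Adj s a → a ≠ c →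
      G₂.skeleton.Adj a c := by
    intro c hc a ha hsc hsa hac
    by_contra hn
    have hc' := (h₁.adj_iff.1 (hs ▸ adj_of_dir hsc)).resolve_left (hsink c hc)
    have ha' := (h₁.adj_iff.1 (hs ▸ hsa)).resolve_left (hsink a ha)
    have := (hv a s c).1 ⟨hac, ha', hc', hs ▸ hn⟩
    exact dir_asymm hsc this.2.2.1
  refine ⟨hab, ?_⟩
  rcases h₂.adj_iff.1 hsa with hsa' | has
  · exact Or.inl (key a ha b hb hsa' hsb hab.symm).symm
  rcases h₂.adj_iff.1 hsb with hsb' | hbs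
  · exact Or.inl (key b hb a ha hsb' hsa hab)
  have hca : a ≠ c := by
    rintro rfl
    exact dir_asymm has hsc
  have hcb : b ≠ c := by
    rintro rfl
    exact dir_asymm hbs hsc
  exact Or.inr ⟨c, ⟨hc, (ne_of_dir hsc).symm⟩, h₂.dir_trans has hsc (key c hc a ha hsc hsa hca),
    h₂.dir_trans hbs hsc (key c hc b hb hsc hsb hcb)⟩

/-- A connection uses `s` either as a vertex or as a common child. Both uses join two neighbours of
`s`, which stay moral neighbours without `s`. -/
theorem MoralConn.diff_singleton {G₁ G₂ : PDAG V} (h₁ : G₁.IsDAG) (h₂ : G₂.IsDAG)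
    (hs : G₁.skeleton = G₂.skeleton) (hv : G₁.SameVStructures G₂) {U Z : Set V} {s c x y : V}
    (hsink : ∀ u ∈ U, ¬ G₁.dir s u) (hc : c ∈ U) (hsc : G₂.dir s c) (hx : x ≠ s) (hy : y ≠ s)
    (h : G₂.MoralConn U Z x y) : G₂.MoralConn (U \ {s}) Z x y := by
  have hadj : ∀ {a}, G₂.MoralAdj U s a → G₂.skeleton.Adj s a := by
    intro a ha
    by_contra hn
    have := (ha.congr hs.symm hv.symm).2
    rcases this with h' | ⟨d, hd, hsd, -⟩
    · exact hn (hs ▸ h')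
    · exact hsink d hd hsd
  have hsymm : ∀ {a b}, G₂.MoralAdj U a b → G₂.MoralAdj U b a := fun h =>
    ⟨h.1.symm, h.2.imp (fun h => h.symm) fun ⟨c, hc, h⟩ => ⟨c, hc, h.2, h.1⟩⟩
  -- While the connection sits at `s`, the invariant records that all moral neighbours of `s`
  -- outside `Z` are already reached.
  have key : ∀ v, G₂.MoralConn U Z x v → (v ≠ s → G₂.MoralConn (U \ {s}) Z x v) ∧
      (v = s → ∀ b ∈ U, b ∉ Z → G₂.MoralAdj U s b → G₂.MoralConn (U \ {s}) Z x b) := by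
    intro v h
    induction h with
    | refl => exact ⟨fun _ => Relation.ReflTransGen.refl, fun h => absurd h hx⟩
    | @tail v w _ hvw ih =>
      obtain ⟨hvU, hwU, hvw⟩ := hvw
      by_cases hvs : v = s
      · subst hvs
        exact ⟨fun _ => ih.2 rfl w hwU.1 hwU.2 hvw, fun h => absurd h.symm hvw.1⟩
      · have hv' := ih.1 hvs
        have step : ∀ b ∈ U, b ∉ Z → b ≠ s → G₂.MoralAdj (U \ {s}) v b →
            G₂.MoralConn (U \ {s}) Z x b := fun b hb hbZ hbs hvb =>
          Relation.ReflTransGen.tail hv' ⟨⟨⟨hvU.1, hvs⟩, hvU.2⟩, ⟨⟨hb, hbs⟩, hbZ⟩, hvb⟩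
        constructor
        · intro hws
          refine step w hwU.1 hwU.2 hws ?_
          rcases hvw.2 with h' | ⟨d, hd, hvd, hwd⟩
          · exact ⟨hvw.1, Or.inl h'⟩
          · by_cases hds : d = s
            · subst hds
              exact moralAdj_diff_singleton h₁ h₂ hs hv hsink hc hsc hvU.1 hwU.1
                (adj_of_dir hvd).symm (adj_of_dir hwd).symm hvw.1
            · exact ⟨hvw.1, Or.inr ⟨d, ⟨hd, hds⟩, hvd, hwd⟩⟩
        · rintro rfl b hb hbZ hsb
          by_cases hvb : v = b
          · rwa [← hvb]
          · exact step b hb hbZ hsb.1.symm (moralAdj_diff_singleton h₁ h₂ hs hv hsink hc hsc hvU.1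
              hb (hadj (hsymm hvw)) (hadj hsb) hvb)
  exact (key y h).1 hy

/-- Moral connection in a set without barren vertices can be restricted to an ancestral set of a DAG
with the same skeleton and v-structures. -/
theorem MoralConn.inter [Finite V] {G₁ G₂ : PDAG V} (h₁ : G₁.IsDAG) (h₂ : G₂.IsDAG)
    (hs : G₁.skeleton = G₂.skeleton) (hv : G₁.SameVStructures G₂) {W U₁ Z : Set V} {x y : V}
    (hW : W ⊆ U₁) (hU₁ : ∀ a b, G₁.dir a b → b ∈ U₁ → a ∈ U₁) (hx : x ∈ W) (hy : y ∈ W) (n : ℕ) :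
    ∀ U : Set V, (U \ U₁).ncard = n → (∀ v ∈ U, v ∉ W → ∃ c ∈ U, G₂.dir v c) →
      G₂.MoralConn U Z x y → G₂.MoralConn (U ∩ U₁) Z x y := by
  obtain ⟨f, hf⟩ := G₁.exists_topological
  induction n with
  | zero =>
    intro U hU _ h
    rw [Set.ncard_eq_zero (Set.toFinite _), Set.sdiff_eq_empty] at hU
    rwa [Set.inter_eq_left.2 hU]
  | succ n ih =>
    intro U hU hch h
    have hne : (U \ U₁).Nonempty := by
      rw [← Set.ncard_pos (Set.toFinite _)]
      omega
    -- The topologically last vertex outside the ancestral set `U₁` is a sink of `G₁` in all of `U`.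
    obtain ⟨s, ⟨hsU, hsU₁⟩, hmax⟩ := Set.exists_max_image (U \ U₁) f (Set.toFinite _) hne
    have hsW : s ∉ W := fun h => hsU₁ (hW h)
    have hsink : ∀ u ∈ U, ¬ G₁.dir s u := by
      intro u hu hsu
      by_cases hu₁ : u ∈ U₁
      · exact hsU₁ (hU₁ s u hsu hu₁)
      · exact absurd (hmax u ⟨hu, hu₁⟩) (not_le.2 (hf s u hsu))
    obtain ⟨c, hc, hsc⟩ := hch s hsU hsW
    have h' := h.diff_singleton h₁ h₂ hs hv hsink hc hsc (fun h => hsW (h ▸ hx))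
      (fun h => hsW (h ▸ hy))
    have hinter : (U \ {s}) ∩ U₁ = U ∩ U₁ := by
      ext u
      simp only [Set.mem_inter_iff, Set.mem_sdiff, Set.mem_singleton_iff]
      constructor
      · rintro ⟨⟨hu, -⟩, hu₁⟩
        exact ⟨hu, hu₁⟩
      · rintro ⟨hu, hu₁⟩
        exact ⟨⟨hu, fun h => hsU₁ (h ▸ hu₁)⟩, hu₁⟩
    rw [← hinter]
    refine ih _ ?_ ?_ h'
    · have : (U \ {s}) \ U₁ = (U \ U₁) \ {s} := by
        ext u
        simp only [Set.mem_sdiff]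
        tauto
      have hcard := Set.ncard_sdiff_singleton_add_one (show s ∈ U \ U₁ from ⟨hsU, hsU₁⟩)
      rw [this]
      omega
    · rintro v ⟨hvU, hvs⟩ hvW
      obtain ⟨d, hd, hvd⟩ := hch v hvU hvW
      -- A vertex that loses its child `s` inherits the child `c` of `s`, so no barren vertex
      -- appears.
      by_cases hds : d = s
      · subst hds
        have hcv : v ≠ c := by
          rintro rfl
          exact dir_asymm hvd hsc
        have hvc : G₂.skeleton.Adj v c := by
          by_contra hn
          have hv' := (h₁.adj_iff.1 (hs ▸ (adj_of_dir hvd).symm)).resolve_left (hsink v hvU)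
          have hc' := (h₁.adj_iff.1 (hs ▸ adj_of_dir hsc)).resolve_left (hsink c hc)
          have := (hv v d c).1 ⟨hcv, hv', hc', hs ▸ hn⟩
          exact dir_asymm hsc this.2.2.1
        exact ⟨c, ⟨hc, (ne_of_dir hsc).symm⟩, h₂.dir_trans hvd hsc hvc⟩
      · exact ⟨d, ⟨hd, hds⟩, hvd⟩

theorem exists_dir_mem_an {G : PDAG V} {W : Set V} {v : V} (hv : v ∈ G.an W) (hvW : v ∉ W) :
    ∃ c ∈ G.an W, G.dir v c := by
  obtain ⟨w, hw, h⟩ := mem_an.1 hv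
  rcases Relation.ReflTransGen.cases_head h with rfl | ⟨c, hvc, hcw⟩
  · exact absurd hw hvW
  · exact ⟨c, mem_an.2 ⟨w, hw, hcw⟩, hvc⟩

/-- DAGs with the same skeleton and the same v-structures are Markov equivalent. -/
theorem markovEquivalent_of_sameVStructures [Finite V] {G₁ G₂ : PDAG V} (h₁ : G₁.IsDAG)
    (h₂ : G₂.IsDAG) (hs : G₁.skeleton = G₂.skeleton) (hv : G₁.SameVStructures G₂) :
    G₁.MarkovEquivalent G₂ := by
  have key : ∀ {G₁ G₂ : PDAG V}, G₁.IsDAG → G₂.IsDAG → G₁.skeleton = G₂.skeleton →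
      G₁.SameVStructures G₂ → ∀ {x y : V} {Z : Set V}, x ∉ Z → y ∉ Z → ¬ G₂.DSep x y Z →
      ¬ G₁.DSep x y Z := by
    intro G₁ G₂ h₁ h₂ hs hv x y Z hx hy h
    rw [h₂.not_dSep_iff_moralConn hx hy] at h
    rw [h₁.not_dSep_iff_moralConn hx hy]
    have := h.inter h₁ h₂ hs hv (W := insert x (insert y Z)) (G₁.subset_an _)
      (fun a b hab hb => mem_an_of_dir hab hb) (Or.inl rfl) (Or.inr (Or.inl rfl)) _ _ rfl
      fun v hv hvW => exists_dir_mem_an hv hvW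
    exact (this.mono Set.inter_subset_right).congr hs.symm hv.symm
  intro x y Z _ hx hy
  exact not_iff_not.1 ⟨key h₂ h₁ hs.symm hv.symm hx hy, key h₁ h₂ hs hv hx hy⟩

theorem MarkovEquivalent.symm {G₁ G₂ : PDAG V} (h : G₁.MarkovEquivalent G₂) :
    G₂.MarkovEquivalent G₁ := fun x y Z hxy hx hy => (h x y Z hxy hx hy).symm

theorem MarkovEquivalent.refl (G : PDAG V) : G.MarkovEquivalent G := fun _ _ _ _ _ _ => Iff.rfl

theorem MarkovEquivalent.trans {G₁ G₂ G₃ : PDAG V} (h : G₁.MarkovEquivalent G₂)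
    (h' : G₂.MarkovEquivalent G₃) : G₁.MarkovEquivalent G₃ :=
  fun x y Z hxy hx hy => (h x y Z hxy hx hy).trans (h' x y Z hxy hx hy)

/-! ### Recovering skeleton and v-structures from d-separation. -/

/-- Nonadjacent vertices of a DAG are separated by their common ancestral set. -/
theorem IsDAG.exists_dSep {G : PDAG V} (hG : G.IsDAG) {x y : V} (hxy : x ≠ y)
    (hadj : ¬ G.skeleton.Adj x y) : ∃ Z : Set V, x ∉ Z ∧ y ∉ Z ∧ G.DSep x y Z := by
  have hx : x ∉ G.an {x, y} \ {x, y} := fun h => h.2 (Or.inl rfl)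
  have hy : y ∉ G.an {x, y} \ {x, y} := fun h => h.2 (Or.inr rfl)
  refine ⟨G.an {x, y} \ {x, y}, hx, hy, ?_⟩
  by_contra hsep
  rw [hG.not_dSep_iff_moralConn hx hy] at hsep
  have hU : G.an (insert x (insert y (G.an {x, y} \ {x, y}))) ⊆ G.an {x, y} := by
    intro v hv
    obtain ⟨w, hw, hvw⟩ := mem_an.1 hv
    have hw' : w ∈ G.an {x, y} := by
      rcases hw with rfl | rfl | hw
      · exact G.subset_an _ (Or.inl rfl)
      · exact G.subset_an _ (Or.inr rfl)
      · exact hw.1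
    obtain ⟨u, hu, hwu⟩ := mem_an.1 hw'
    exact mem_an.2 ⟨u, hu, hvw.trans hwu⟩
  -- Outside `Z` only `x` and `y` remain, so they would have a common child that is an ancestor of
  -- one of them, giving a cycle.
  rcases Relation.ReflTransGen.cases_head hsep with h | ⟨v, ⟨-, hv, hne, hxv⟩, -⟩
  · exact hxy h
  · have hvxy : v ∈ ({x, y} : Set V) := by
      by_contra hn
      exact hv.2 ⟨hU hv.1, hn⟩
    obtain rfl : v = y := hvxy.resolve_left hne.symm
    obtain ⟨c, hc, hxc, hvc⟩ := hxv.resolve_left hadj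
    obtain ⟨w, hw, hcw⟩ := mem_an.1 (hU hc)
    rcases hw with rfl | rfl
    · exact G.acyclic _ (Relation.TransGen.head' hxc hcw)
    · exact G.acyclic _ (Relation.TransGen.head' hvc hcw)

theorem not_dSep_of_adj {G : PDAG V} {x y : V} (h : G.skeleton.Adj x y) (Z : Set V) :
    ¬ G.DSep x y Z :=
  not_dSep_iff_exists_active.2 ⟨[y], by simp, by simpa using h.ne, active_pair.2 h⟩

theorem MarkovEquivalent.skeleton_eq {G₁ G₂ : PDAG V} (h₁ : G₁.IsDAG) (h₂ : G₂.IsDAG)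
    (h : G₁.MarkovEquivalent G₂) : G₁.skeleton = G₂.skeleton := by
  have key : ∀ {G₁ G₂ : PDAG V}, G₂.IsDAG → G₁.MarkovEquivalent G₂ → ∀ {x y : V},
      G₁.skeleton.Adj x y → G₂.skeleton.Adj x y := by
    intro G₁ G₂ h₂ h x y hxy
    by_contra hn
    obtain ⟨Z, hx, hy, hZ⟩ := h₂.exists_dSep hxy.ne hn
    exact not_dSep_of_adj hxy Z ((h x y Z hxy.ne hx hy).2 hZ)
  ext x y
  exact ⟨key h₂ h, key h₁ h.symm⟩

/-- If `z` were a non-collider in `G₂`, any set separating `x` and `y` would contain `z`; but that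
opens the collider `z` in `G₁`. -/
theorem MarkovEquivalent.sameVStructures {G₁ G₂ : PDAG V} (h₁ : G₁.IsDAG) (h₂ : G₂.IsDAG)
    (h : G₁.MarkovEquivalent G₂) : G₁.SameVStructures G₂ := by
  have key : ∀ {G₁ G₂ : PDAG V}, G₁.IsDAG → G₂.IsDAG → G₁.MarkovEquivalent G₂ → ∀ {x z y : V},
      G₁.IsVStructure x z y → G₂.IsVStructure x z y := by
    intro G₁ G₂ h₁ h₂ h x z y hv
    have hs := h.skeleton_eq h₁ h₂
    have hnadj : ¬ G₂.skeleton.Adj x y := hs ▸ hv.2.2.2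
    have hxz := adj_of_dir hv.2.1
    have hyz := adj_of_dir hv.2.2.1
    have hnodup : [x, z, y].Nodup := by simp [hxz.ne, hyz.ne.symm, hv.1]
    obtain ⟨Z, hx, hy, hZ⟩ := h₂.exists_dSep hv.1 hnadj
    have hZ' := (h x y Z hv.1 hx hy).2 hZ
    by_contra hn
    have hn' : ¬ (G₂.dir x z ∧ G₂.dir y z) := fun h => hn ⟨hv.1, h.1, h.2, hnadj⟩
    have hz : z ∈ Z := by
      by_contra hz
      exact not_dSep_iff_exists_active.2 ⟨[z, y], by simp, hnodup, active_cons_cons_cons.2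
        ⟨hs ▸ hxz, Or.inr ⟨hn', hz⟩, active_pair.2 (hs ▸ hyz.symm)⟩⟩ hZ
    exact not_dSep_iff_exists_active.2 ⟨[z, y], by simp, hnodup, active_cons_cons_cons.2
      ⟨hxz, Or.inl ⟨hv.2.1, hv.2.2.1, G₁.subset_an Z hz⟩, active_pair.2 hyz.symm⟩⟩ hZ'
  exact fun x z y => ⟨key h₁ h₂ h, key h₂ h₁ h.symm⟩

theorem IsCPDAGOf.sameVStructures {C G : PDAG V} (hG : G.IsDAG) (h : C.IsCPDAGOf G) :
    C.SameVStructures G := by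
  intro x z y
  constructor
  · rintro ⟨hxy, hxz, hyz, hn⟩
    exact ⟨hxy, (h.2 x z).1 hxz G hG (.refl G), (h.2 y z).1 hyz G hG (.refl G), h.1 ▸ hn⟩
  · intro hv
    have hv' : ∀ G' : PDAG V, G'.IsDAG → G'.MarkovEquivalent G → G'.IsVStructure x z y :=
      fun G' hG' hE => (hE.sameVStructures hG' hG x z y).2 hv
    exact ⟨hv.1, (h.2 x z).2 fun G' hG' hE => (hv' G' hG' hE).2.1,
      (h.2 y z).2 fun G' hG' hE => (hv' G' hG' hE).2.2.1, h.1 ▸ hv.2.2.2⟩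

/-- The class represented by a CPDAG consists of the DAGs with its skeleton and v-structures. -/
theorem IsCPDAG.mem_markovClass_iff [Finite V] {C G : PDAG V} (hC : C.IsCPDAG) :
    G ∈ C.markovClass ↔ G.IsDAG ∧ G.skeleton = C.skeleton ∧ G.SameVStructures C := by
  constructor
  · rintro ⟨hG, h⟩
    exact ⟨hG, h.1.symm, (h.sameVStructures hG).symm⟩
  · rintro ⟨hG, hs, hv⟩
    obtain ⟨G₁, hG₁, h⟩ := hC
    have hE : G.MarkovEquivalent G₁ := markovEquivalent_of_sameVStructures hG hG₁
      (hs.trans h.1) (hv.trans (h.sameVStructures hG₁))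
    refine ⟨hG, hs.symm, fun x y => (h.2 x y).trans ?_⟩
    exact forall₂_congr fun G' _ => imp_congr_left
      ⟨fun h' => h'.trans hE.symm, fun h' => h'.trans hE⟩

/-! ### Elimination orders -/

/-- The edge `x → y` occurs in all members of the family. -/
def Forced (F : Set (PDAG V)) (x y : V) : Prop := ∀ G ∈ F, G.dir x y

/-- The neighbours of `s` in `U` are pairwise adjacent. -/
def IsSimplicial (A : SimpleGraph V) (U : Set V) (s : V) : Prop :=
  ∀ a ∈ U, ∀ b ∈ U, A.Adj s a → A.Adj s b → a ≠ b → A.Adj a b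

/-- No two nonadjacent vertices of `U` have a common child in `U`. -/
def IsMoralOn (G : PDAG V) (U : Set V) : Prop :=
  ∀ a ∈ U, ∀ b ∈ U, ∀ c ∈ U, G.dir a b → G.dir c b → a ≠ c → G.skeleton.Adj a c

theorem IsMoralOn.mono {G : PDAG V} {U U' : Set V} (h : G.IsMoralOn U') (hU : U ⊆ U') :
    G.IsMoralOn U :=
  fun a ha b hb c hc => h a (hU ha) b (hU hb) c (hU hc)

/-- Dirac's theorem on chordal graphs. The topologically last vertex `s` is simplicial. Of a
nonadjacent simplicial pair in the rest, one member is not adjacent to `s`; it remains simplicial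
and is paired with `s`. -/
theorem IsDAG.exists_simplicial_pair [Finite V] {G : PDAG V} (hG : G.IsDAG) (n : ℕ) :
    ∀ U : Set V, U.ncard = n → G.IsMoralOn U → ¬ G.skeleton.IsClique U →
      ∃ x ∈ U, ∃ y ∈ U, x ≠ y ∧ ¬ G.skeleton.Adj x y ∧
        IsSimplicial G.skeleton U x ∧ IsSimplicial G.skeleton U y := by
  obtain ⟨f, hf⟩ := G.exists_topological
  induction n with
  | zero =>
    intro U hU _ hcl
    rw [Set.ncard_eq_zero (Set.toFinite _)] at hU
    simp [hU] at hcl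
  | succ n ih =>
    intro U hU hm hcl
    have hne : U.Nonempty := by
      rw [← Set.ncard_pos (Set.toFinite _)]
      omega
    obtain ⟨s, hsU, hmax⟩ := Set.exists_max_image U f (Set.toFinite _) hne
    have hin : ∀ a ∈ U, G.skeleton.Adj s a → G.dir a s := fun a ha hsa =>
      (hG.adj_iff.1 hsa).resolve_left fun h => absurd (hmax a ha) (not_le.2 (hf s a h))
    have hs : IsSimplicial G.skeleton U s := fun a ha b hb hsa hsb hab =>
      hm a ha s hsU b hb (hin a ha hsa) (hin b hb hsb) hab
    by_cases hcl' : G.skeleton.IsClique (U \ {s})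
    · obtain ⟨x, hx, hxs, hnadj⟩ : ∃ x ∈ U, x ≠ s ∧ ¬ G.skeleton.Adj x s := by
        by_contra hcon
        push Not at hcon
        refine hcl fun a ha b hb hab => ?_
        by_cases has : a = s
        · subst has
          exact (hcon b hb hab.symm).symm
        · by_cases hbs : b = s
          · subst hbs
            exact hcon a ha hab
          · exact hcl' ⟨ha, has⟩ ⟨hb, hbs⟩ hab
      refine ⟨x, hx, s, hsU, hxs, hnadj, fun a ha b hb hxa hxb hab => ?_, hs⟩
      refine hcl' ⟨ha, ?_⟩ ⟨hb, ?_⟩ hab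
      · rintro rfl
        exact hnadj hxa
      · rintro rfl
        exact hnadj hxb
    · have hcard := Set.ncard_sdiff_singleton_add_one hsU
      obtain ⟨x, hx, y, hy, hxy, hnadj, hsx, hsy⟩ :=
        ih (U \ {s}) (by omega) (hm.mono Set.sdiff_subset) hcl'
      have hlift : ∀ x, IsSimplicial G.skeleton (U \ {s}) x → ¬ G.skeleton.Adj s x →
          IsSimplicial G.skeleton U x := by
        intro x hsx hsx' a ha b hb hxa hxb hab
        refine hsx a ⟨ha, ?_⟩ b ⟨hb, ?_⟩ hxa hxb hab
        · rintro rfl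
          exact hsx' hxa.symm
        · rintro rfl
          exact hsx' hxb.symm
      by_cases h₁ : G.skeleton.Adj s x
      · have h₂ : ¬ G.skeleton.Adj s y := fun h₂ => hnadj (hs x hx.1 y hy.1 h₁ h₂ hxy)
        exact ⟨s, hsU, y, hy.1, fun h => hy.2 h.symm, h₂, hs, hlift y hsy h₂⟩
      · exact ⟨s, hsU, x, hx.1, fun h => hx.2 h.symm, h₁, hs, hlift x hsx h₁⟩

/-- A vertex which may come last in an orientation of the subgraph induced by `U`. -/
def IsPotentialSink (F : Set (PDAG V)) (A : SimpleGraph V) (U : Set V) (s : V) : Prop :=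
  IsSimplicial A U s ∧ ∀ u ∈ U, ¬ Forced F s u

section Family

variable {F : Set (PDAG V)} {A : SimpleGraph V}

theorem Forced.trans (hD : ∀ G ∈ F, G.IsDAG) (hA : ∀ G ∈ F, G.skeleton = A) {x y z : V}
    (hxy : Forced F x y) (hyz : Forced F y z) (hxz : A.Adj x z) : Forced F x z :=
  fun G hG => (hD G hG).dir_trans (hxy G hG) (hyz G hG) (hA G hG ▸ hxz)

/-- If `x` is simplicial in `U`, then a potential sink of `U \ {x}` or `x` itself is a potential
sink of `U`. -/
theorem IsPotentialSink.of_diff_singleton (hne : F.Nonempty) (hD : ∀ G ∈ F, G.IsDAG)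
    (hA : ∀ G ∈ F, G.skeleton = A) {U : Set V} (hm : ∀ G ∈ F, G.IsMoralOn U) {x s : V}
    (hxU : x ∈ U) (hx : IsSimplicial A U x) (hsU : s ∈ U \ {x})
    (hs : IsPotentialSink F A (U \ {x}) s) :
    IsPotentialSink F A U s ∨ IsPotentialSink F A U x := by
  obtain ⟨G₀, hG₀⟩ := hne
  by_contra hcon
  push Not at hcon
  obtain ⟨hns, hnx⟩ := hcon
  obtain ⟨y, hyU, hxy⟩ : ∃ y ∈ U, Forced F x y := by
    by_contra hcon
    push Not at hcon
    exact hnx ⟨hx, hcon⟩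
  have hadj : ∀ {a b}, Forced F a b → A.Adj a b := fun h => hA G₀ hG₀ ▸ adj_of_dir (h G₀ hG₀)
  have hyx : y ≠ x := (hadj hxy).ne.symm
  by_cases hsx : Forced F s x
  · have hsy : s ≠ y := by
      rintro rfl
      exact dir_asymm (hsx G₀ hG₀) (hxy G₀ hG₀)
    have := hx s hsU.1 y hyU (hadj hsx).symm (hadj hxy) hsy
    exact hs.2 y ⟨hyU, hyx⟩ (Forced.trans hD hA hsx hxy this)
  · have hout : ∀ u ∈ U, ¬ Forced F s u := by
      intro u hu hsu
      by_cases hux : u = x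
      · exact hsx (hux ▸ hsu)
      · exact hs.2 u ⟨hu, hux⟩ hsu
    obtain ⟨z, hz, hsz, hsx', hxz, hnadj⟩ : ∃ z ∈ U, A.Adj s z ∧ A.Adj s x ∧ x ≠ z ∧
        ¬ A.Adj x z := by
      by_contra hcon
      push Not at hcon
      refine hns ⟨fun a ha b hb hsa hsb hab => ?_, hout⟩
      by_cases hax : a = x
      · subst hax
        exact hcon b hb hsb hsa hab
      · by_cases hbx : b = x
        · subst hbx
          exact (hcon a ha hsa hsb hab.symm).symm
        · exact hs.1 a ⟨ha, hax⟩ b ⟨hb, hbx⟩ hsa hsb hab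
    have hmoral : ∀ G ∈ F, ∀ b ∈ U, G.dir x b → ¬ G.dir z b := fun G hG b hb hxb hzb =>
      hnadj (hA G hG ▸ hm G hG x hxU b hb z hz hxb hzb hxz)
    have hsz' : ∀ G ∈ F, G.dir x s → G.dir s z := fun G hG hxs =>
      ((hD G hG).adj_iff.1 (hA G hG ▸ hsz)).resolve_right (hmoral G hG s hsU.1 hxs)
    -- It remains to force `s → z`. In a member with `x → s` this avoids a v-structure; in general
    -- `z → s` would give `x → y → z → s`, hence `x → s` and again a collider with `x`, `z`
    -- nonadjacent.
    refine hout z hz ?_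
    by_cases hxs : Forced F x s
    · exact fun G hG => hsz' G hG (hxs G hG)
    have hsy : s ≠ y := by
      rintro rfl
      exact hxs hxy
    have hsyA : A.Adj s y := hx s hsU.1 y hyU hsx'.symm (hadj hxy) hsy
    have hyz : y ≠ z := by
      rintro rfl
      exact hnadj (hadj hxy)
    have hyzA : A.Adj y z := hs.1 y ⟨hyU, hyx⟩ z ⟨hz, hxz.symm⟩ hsyA hsz hyz
    intro G hG
    have hyz' : G.dir y z := ((hD G hG).adj_iff.1 (hA G hG ▸ hyzA)).resolve_right
      (hmoral G hG y hyU (hxy G hG))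
    refine ((hD G hG).adj_iff.1 (hA G hG ▸ hsz)).resolve_right fun hzs => ?_
    have hys := (hD G hG).dir_trans hyz' hzs (hA G hG ▸ hsyA.symm)
    have hxs' := (hD G hG).dir_trans (hxy G hG) hys (hA G hG ▸ hsx'.symm)
    exact hmoral G hG s hsU.1 hxs' hzs

/-- If `t` has no forced edge to the clique `M`, then some potential sink lies outside of `M`. -/
theorem exists_potentialSink_notMem [Finite V] (hne : F.Nonempty) (hD : ∀ G ∈ F, G.IsDAG)
    (hA : ∀ G ∈ F, G.skeleton = A) {M : Set V} {t : V} (hcl : A.IsClique (insert t M))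
    (htM : t ∉ M) (hfor : ∀ m ∈ M, ¬ Forced F t m) (n : ℕ) :
    ∀ U : Set V, U.ncard = n → (∀ G ∈ F, G.IsMoralOn U) → t ∈ U → M ⊆ U →
      ∃ s ∈ U, s ∉ M ∧ IsPotentialSink F A U s := by
  obtain ⟨G₀, hG₀⟩ := id hne
  induction n with
  | zero =>
    intro U hU _ ht
    rw [Set.ncard_eq_zero (Set.toFinite _)] at hU
    simp [hU] at ht
  | succ n ih =>
    intro U hU hm ht hMU
    by_cases hclU : A.IsClique U
    · obtain ⟨f, hf⟩ := G₀.exists_topological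
      -- In a clique forced edges compose, so the last vertex among `t` and its forced children has
      -- no forced child; it avoids `M` by `hfor`.
      obtain ⟨s, ⟨hsU, hts⟩, hmax⟩ := Set.exists_max_image {u | u ∈ U ∧ (u = t ∨ Forced F t u)} f
        (Set.toFinite _) ⟨t, ht, Or.inl rfl⟩
      refine ⟨s, hsU, ?_, fun a ha b hb _ _ hab => hclU ha hb hab, fun u hu hsu => ?_⟩
      · rcases hts with rfl | hts
        · exact htM
        · exact fun h => hfor s h hts
      · have hlt := hf s u (hsu G₀ hG₀)
        refine absurd (hmax u ⟨hu, Or.inr ?_⟩) (not_le.2 hlt)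
        rcases hts with rfl | hts
        · exact hsu
        · refine Forced.trans hD hA hts hsu (hclU ht hu ?_)
          rintro rfl
          exact dir_asymm (hts G₀ hG₀) (hsu G₀ hG₀)
    · have hAG := hA G₀ hG₀
      obtain ⟨x₁, hx₁, x₂, hx₂, hx₁₂, hnadj, hs₁, hs₂⟩ :=
        (hD G₀ hG₀).exists_simplicial_pair _ U rfl (hm G₀ hG₀) (hAG ▸ hclU)
      rw [hAG] at hnadj hs₁ hs₂
      -- Two nonadjacent vertices cannot both lie in the clique `insert t M`.
      obtain ⟨x, hxU, hxM, hx⟩ : ∃ x ∈ U, x ∉ insert t M ∧ IsSimplicial A U x := by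
        by_cases h₁ : x₁ ∈ insert t M
        · exact ⟨x₂, hx₂, fun h₂ => hnadj (hcl h₁ h₂ hx₁₂), hs₂⟩
        · exact ⟨x₁, hx₁, h₁, hs₁⟩
      have hcard := Set.ncard_sdiff_singleton_add_one hxU
      obtain ⟨s, hsU, hsM, hs⟩ := ih (U \ {x}) (by omega)
        (fun G hG => (hm G hG).mono Set.sdiff_subset)
        ⟨ht, fun h => hxM (Or.inl (Set.mem_singleton_iff.1 h).symm)⟩
        fun m hmM => ⟨hMU hmM, fun h => hxM (Or.inr (Set.mem_singleton_iff.1 h ▸ hmM))⟩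
      rcases hs.of_diff_singleton hne hD hA hm hxU hx hsU with h | h
      · exact ⟨s, hsU.1, hsM, h⟩
      · exact ⟨x, hxU, fun hxM' => hxM (Or.inr hxM'), h⟩

/-- The numbering `g` orients the subgraph induced by `U` without v-structures and in accordance
with the forced edges. -/
structure IsAdmissible (F : Set (PDAG V)) (A : SimpleGraph V) (U : Set V) (g : V → ℕ) :
    Prop where
  lt_of_forced : ∀ u ∈ U, ∀ v ∈ U, Forced F u v → g u < g v
  ne_of_adj : ∀ u ∈ U, ∀ v ∈ U, A.Adj u v → g u ≠ g v
  moral : ∀ a ∈ U, ∀ b ∈ U, ∀ c ∈ U, A.Adj a b → A.Adj c b → g a < g b → g c < g b → a ≠ c →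
    A.Adj a c

theorem exists_isAdmissible [Finite V] (hne : F.Nonempty) (hD : ∀ G ∈ F, G.IsDAG)
    (hA : ∀ G ∈ F, G.skeleton = A) {U : Set V} (hm : ∀ G ∈ F, G.IsMoralOn U) :
    ∃ g, IsAdmissible F A U g := by
  obtain ⟨G, hG⟩ := hne
  obtain ⟨f, hf⟩ := G.exists_topological
  have hlt : ∀ {a b}, A.Adj a b → f a < f b → G.dir a b := fun {a b} hab h =>
    ((hD G hG).adj_iff.1 (hA G hG ▸ hab)).resolve_right fun h' => absurd (hf b a h') (by omega)
  refine ⟨f, fun u _ v _ h => hf u v (h G hG), fun u _ v _ h h' => ?_, ?_⟩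
  · rcases (hD G hG).adj_iff.1 (hA G hG ▸ h) with h'' | h'' <;>
    · have := hf _ _ h''
      omega
  · intro a ha b hb c hc hab hcb h₁ h₂ hac
    exact hA G hG ▸ hm G hG a ha b hb c hc (hlt hab h₁) (hlt hcb h₂) hac

/-- An admissible numbering of `U \ {s}` extends to one of `U` with the potential sink `s` last. -/
theorem IsAdmissible.exists_extend [Finite V] {U : Set V} {s : V} {g : V → ℕ}
    (hs : IsPotentialSink F A U s) (hg : IsAdmissible F A (U \ {s}) g) :
    ∃ g', IsAdmissible F A U g' ∧ (∀ v, v ≠ s → g' v = g v) ∧ ∀ v, v ≠ s → g' v < g' s := by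
  classical
  obtain ⟨N, hN⟩ : ∃ N, ∀ v, g v < N := by
    obtain ⟨N, hN⟩ := (Set.finite_range g).bddAbove
    exact ⟨N + 1, fun v => Nat.lt_succ_of_le (hN ⟨v, rfl⟩)⟩
  have hgs : ∀ v, v ≠ s → Function.update g s N v = g v := fun v hv => by simp [hv]
  have hlast : ∀ v, v ≠ s → Function.update g s N v < Function.update g s N s := fun v hv => by
    simpa [hv] using hN v
  refine ⟨Function.update g s N, ⟨fun u hu v hv huv => ?_, fun u hu v hv huv => ?_,
    fun a ha b hb c hc hab hcb h₁ h₂ hac => ?_⟩, hgs, hlast⟩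
  · have hus : u ≠ s := by
      rintro rfl
      exact hs.2 v hv huv
    by_cases hvs : v = s
    · exact hvs ▸ hlast u hus
    · rw [hgs u hus, hgs v hvs]
      exact hg.lt_of_forced u ⟨hu, hus⟩ v ⟨hv, hvs⟩ huv
  · by_cases hus : u = s
    · subst hus
      exact (hlast v huv.ne.symm).ne'
    · by_cases hvs : v = s
      · subst hvs
        exact (hlast u hus).ne
      · rw [hgs u hus, hgs v hvs]
        exact hg.ne_of_adj u ⟨hu, hus⟩ v ⟨hv, hvs⟩ huv
  · by_cases hbs : b = s
    · subst hbs
      exact hs.1 a ha c hc hab.symm hcb.symm hac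
    · have hlt : ∀ {a}, Function.update g s N a < Function.update g s N b → a ≠ s := by
        rintro a h rfl
        exact lt_asymm h (hlast b hbs)
      have has := hlt h₁
      have hcs := hlt h₂
      rw [hgs a has, hgs b hbs] at h₁
      rw [hgs c hcs, hgs b hbs] at h₂
      exact hg.moral a ⟨ha, has⟩ b ⟨hb, hbs⟩ c ⟨hc, hcs⟩ hab hcb h₁ h₂ hac

/-- There is an admissible numbering in which the clique `M` precedes `t`. -/
theorem exists_isAdmissible_lt [Finite V] (hne : F.Nonempty) (hD : ∀ G ∈ F, G.IsDAG)
    (hA : ∀ G ∈ F, G.skeleton = A) {M : Set V} {t : V} (hcl : A.IsClique (insert t M))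
    (htM : t ∉ M) (hfor : ∀ m ∈ M, ¬ Forced F t m) (n : ℕ) :
    ∀ U : Set V, U.ncard = n → (∀ G ∈ F, G.IsMoralOn U) → t ∈ U → M ⊆ U →
      ∃ g, IsAdmissible F A U g ∧ ∀ m ∈ M, g m < g t := by
  induction n with
  | zero =>
    intro U hU _ ht
    rw [Set.ncard_eq_zero (Set.toFinite _)] at hU
    simp [hU] at ht
  | succ n ih =>
    intro U hU hm ht hMU
    obtain ⟨s, hsU, hsM, hs⟩ :=
      exists_potentialSink_notMem hne hD hA hcl htM hfor _ U rfl hm ht hMU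
    have hm' : ∀ G ∈ F, G.IsMoralOn (U \ {s}) := fun G hG => (hm G hG).mono Set.sdiff_subset
    have hMs : ∀ m ∈ M, m ≠ s := fun m hmM h => hsM (h ▸ hmM)
    -- Once `t` itself is placed last, the order of the rest is irrelevant.
    by_cases hst : t = s
    · obtain ⟨g, hg⟩ := exists_isAdmissible hne hD hA hm'
      obtain ⟨g', hg', -, hlast⟩ := hg.exists_extend hs
      exact ⟨g', hg', fun m hmM => hst ▸ hlast m (hMs m hmM)⟩
    · have hcard := Set.ncard_sdiff_singleton_add_one hsU
      obtain ⟨g, hg, hgt⟩ := ih (U \ {s}) (by omega) hm' ⟨ht, hst⟩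
        fun m hmM => ⟨hMU hmM, hMs m hmM⟩
      obtain ⟨g', hg', heq, -⟩ := hg.exists_extend hs
      refine ⟨g', hg', fun m hmM => ?_⟩
      rw [heq m (hMs m hmM), heq t hst]
      exact hgt m hmM

end Family

/-! ### Compelled edges -/

/-- The edges obtained from the v-structures of `G` by Meek's first three orientation rules. -/
inductive Compelled (G : PDAG V) : V → V → Prop
  | vstructure {x z y : V} : G.IsVStructure x z y → Compelled G x z
  | away {a b c : V} : Compelled G a b → G.skeleton.Adj b c → a ≠ c → ¬ G.skeleton.Adj a c →
      ¬ G.IsVStructure a b c → Compelled G b c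
  | trans {a b c : V} : Compelled G a b → Compelled G b c → G.skeleton.Adj a c → Compelled G a c
  | kite {a b d e : V} : G.IsVStructure d b e → G.skeleton.Adj a d → G.skeleton.Adj a e →
      G.skeleton.Adj a b → ¬ G.IsVStructure d a e → Compelled G a b

theorem Compelled.dir {G G' : PDAG V} (hG' : G'.IsDAG) (hs : G'.skeleton = G.skeleton)
    (hv : G'.SameVStructures G) {x y : V} (h : G.Compelled x y) : G'.dir x y := by
  induction h with
  | vstructure h => exact ((hv _ _ _).2 h).2.1
  | @away a b c _ hbc hne hac hn ih =>
    refine (hG'.adj_iff.1 (hs ▸ hbc)).resolve_right fun hcb => hn ?_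
    exact (hv _ _ _).1 ⟨hne, ih, hcb, hs ▸ hac⟩
  | trans _ _ hac ih₁ ih₂ => exact hG'.dir_trans ih₁ ih₂ (hs ▸ hac)
  | @kite a b d e h had hae hab hn =>
    refine (hG'.adj_iff.1 (hs ▸ hab)).resolve_right fun hba => hn ?_
    have h' := (hv _ _ _).2 h
    exact (hv _ _ _).1 ⟨h.1, hG'.dir_trans h'.2.1 hba (hs ▸ had.symm),
      hG'.dir_trans h'.2.2.1 hba (hs ▸ hae.symm), h'.2.2.2⟩

/-- The adjacent pairs without a compelled orientation. -/
def Free (G : PDAG V) (x y : V) : Prop :=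
  G.skeleton.Adj x y ∧ ¬ G.Compelled x y ∧ ¬ G.Compelled y x

theorem Free.symm {G : PDAG V} {x y : V} (h : G.Free x y) : G.Free y x :=
  ⟨h.1.symm, h.2.2, h.2.1⟩

theorem Compelled.adj_of_free {G : PDAG V} {a b c : V} (h : G.Compelled a b) (hbc : G.Free b c) :
    G.skeleton.Adj a c := by
  by_contra hn
  have hac : a ≠ c := by
    rintro rfl
    exact hbc.2.2 h
  by_cases hv : G.IsVStructure a b c
  · exact hbc.2.2 (.vstructure hv.symm)
  · exact hbc.2.1 (h.away hbc.1 hac hn hv)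

/-- Both parents of `b` are adjacent to `c`; if they did not collide at `c`, the kite rule would
orient `c → b`. -/
theorem IsVStructure.of_free {G : PDAG V} {a b c d : V} (h : G.IsVStructure a b d)
    (hbc : G.Free b c) : G.IsVStructure a c d := by
  by_contra hn
  exact hbc.2.2 (.kite h ((Compelled.vstructure h).adj_of_free hbc).symm
    ((Compelled.vstructure h.symm).adj_of_free hbc).symm hbc.1.symm hn)

/-- The compelled and the free edges form a chain graph. -/
theorem Compelled.of_free {G : PDAG V} {a b c : V} (h : G.Compelled a b) (hbc : G.Free b c) :
    G.Compelled a c := by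
  induction h generalizing c with
  | vstructure h => exact .vstructure (h.of_free hbc)
  | @away d a b hda hab hne hdb hn ih =>
    have hac := (hda.away hab hne hdb hn).adj_of_free hbc
    -- If `a → c` is not compelled, then `a - c` is free and induction gives `d → c`. As `d` and `b`
    -- are nonadjacent, this compels the edge between `b` and `c`.
    by_contra hcon
    have hca : ¬ G.Compelled c a := fun h =>
      hbc.2.2 (h.trans (hda.away hab hne hdb hn) hbc.1.symm)
    have hdc := ih ⟨hac, hcon, hca⟩
    by_cases hv : G.IsVStructure d c b
    · exact hbc.2.1 (.vstructure hv.symm)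
    · exact hbc.2.2 (hdc.away hbc.1.symm hne hdb hv)
  | @trans a d b had hdb hab ih₁ ih₂ =>
    exact had.trans (ih₂ hbc) ((had.trans hdb hab).adj_of_free hbc)
  | @kite a b d e h had hae hab hn =>
    exact .kite (h.of_free hbc) had hae ((Compelled.kite h had hae hab hn).adj_of_free hbc) hn

/-- The component of `t` in the graph of the free edges. -/
def chainComponent (G : PDAG V) (t : V) : Set V := {v | Relation.ReflTransGen G.Free t v}

theorem Compelled.of_mem_chainComponent {G : PDAG V} {p t u v : V} (h : G.Compelled p u)
    (hu : u ∈ G.chainComponent t) (hv : v ∈ G.chainComponent t) : G.Compelled p v := by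
  have ht : G.Compelled p t := by
    change Relation.ReflTransGen G.Free t u at hu
    induction hu with
    | refl => exact h
    | tail _ huv ih => exact ih (h.of_free huv.symm)
  change Relation.ReflTransGen G.Free t v at hv
  induction hv with
  | refl => exact ht
  | tail _ huv ih => exact ih.of_free huv

theorem IsDAG.not_compelled_of_mem {G : PDAG V} (hG : G.IsDAG) {t u v : V}
    (hu : u ∈ G.chainComponent t) (hv : v ∈ G.chainComponent t) : ¬ G.Compelled u v := fun h =>
  G.dir_irrefl u ((h.of_mem_chainComponent hv hu).dir hG rfl fun _ _ _ => Iff.rfl)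

theorem compelled_or_of_notMem {G : PDAG V} {t u w : V} (hu : u ∈ G.chainComponent t)
    (hw : w ∉ G.chainComponent t) (h : G.skeleton.Adj u w) :
    G.Compelled u w ∨ G.Compelled w u := by
  by_contra hcon
  push Not at hcon
  exact hw (Relation.ReflTransGen.tail hu ⟨h, hcon.1, hcon.2⟩)

/-- The edges of `G`, redirected inside of `T` according to the numbering `g`. -/
def redirectedDir (G : PDAG V) (T : Set V) (g : V → ℕ) (x y : V) : Prop :=
  (x ∈ T ∧ y ∈ T ∧ G.skeleton.Adj x y ∧ g x < g y) ∨ (¬ (x ∈ T ∧ y ∈ T) ∧ G.dir x y)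

theorem redirectedDir_acyclic [Finite V] {G : PDAG V} (hG : G.IsDAG) (t : V) (g : V → ℕ) (x : V) :
    ¬ Relation.TransGen (G.redirectedDir (G.chainComponent t) g) x x := by
  classical
  set T := G.chainComponent t with hT
  obtain ⟨f, hf⟩ := G.exists_topological
  obtain ⟨r, hr, hmin⟩ := Set.exists_min_image T f (Set.toFinite _)
    ⟨t, Relation.ReflTransGen.refl⟩
  -- The whole component is moved to the position of its first vertex `r` and ordered by `g` inside.
  -- This respects edges entering from outside, because their tails are also parents of `r`.
  let k : V → ℕ ×ₗ ℕ := fun v => if v ∈ T then toLex (f r, g v) else toLex (f v, 0)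
  have hk : ∀ a b, G.redirectedDir T g a b → k a < k b := by
    rintro a b (⟨ha, hb, -, hab⟩ | ⟨hn, hab⟩)
    · simp only [k, ha, hb, if_true, Prod.Lex.toLex_lt_toLex]
      simpa using hab
    · have hlt := hf a b hab
      by_cases ha : a ∈ T
      · have hb : b ∉ T := fun hb => hn ⟨ha, hb⟩
        simp only [k, ha, hb, if_true, if_false, Prod.Lex.toLex_lt_toLex]
        exact Or.inl ((hmin a ha).trans_lt hlt)
      · by_cases hb : b ∈ T
        · simp only [k, ha, hb, if_true, if_false, Prod.Lex.toLex_lt_toLex]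
          refine Or.inl (hf a r ?_)
          rcases compelled_or_of_notMem hb ha (adj_of_dir hab).symm with h | h
          · exact absurd (h.dir hG rfl fun _ _ _ => Iff.rfl) (dir_asymm hab)
          · exact (h.of_mem_chainComponent hb hr).dir hG rfl fun _ _ _ => Iff.rfl
        · simp only [k, ha, hb, if_false, Prod.Lex.toLex_lt_toLex]
          exact Or.inl hlt
  have hlt : ∀ {a b}, Relation.TransGen (G.redirectedDir T g) a b → k a < k b := by
    intro a b h
    induction h with
    | single h => exact hk _ _ h
    | tail _ h ih => exact ih.trans (hk _ _ h)
  exact fun h => lt_irrefl _ (hlt h)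

/-- The DAG obtained by redirecting the edges inside of a chain component. -/
def redirect [Finite V] {G : PDAG V} (hG : G.IsDAG) (t : V) (g : V → ℕ) : PDAG V where
  dir := G.redirectedDir (G.chainComponent t) g
  und _ _ := False
  und_symm _ _ := id
  und_irrefl _ := id
  dir_not_und _ _ _ := id
  acyclic := redirectedDir_acyclic hG t g

/-- If no edge between the clique `M` and `t` is forced, then some DAG with the common skeleton and
the common v-structures of the family contains all forced edges and all edges from `M` to `t`. -/
theorem exists_forall_dir [Finite V] {F : Set (PDAG V)} {G₀ : PDAG V} (hG₀ : G₀ ∈ F)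
    (hD : ∀ G ∈ F, G.IsDAG) (hs : ∀ G ∈ F, G.skeleton = G₀.skeleton)
    (hv : ∀ G ∈ F, G.SameVStructures G₀) {M : Set V} {t : V} (hcl : G₀.skeleton.IsClique M)
    (hadj : ∀ m ∈ M, G₀.skeleton.Adj t m) (hout : ∀ m ∈ M, ¬ Forced F t m)
    (hin : ∀ m ∈ M, ¬ Forced F m t) :
    ∃ G : PDAG V, G.IsDAG ∧ G.skeleton = G₀.skeleton ∧ G.SameVStructures G₀ ∧
      (∀ x y, Forced F x y → G.dir x y) ∧ ∀ m ∈ M, G.dir m t := by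
  have hD₀ := hD G₀ hG₀
  set T := G₀.chainComponent t with hT
  have hforced : ∀ {x y}, G₀.Compelled x y → Forced F x y := fun h G hG =>
    h.dir (hD G hG) (hs G hG) (hv G hG)
  have htT : t ∈ T := Relation.ReflTransGen.refl
  have hMT : M ⊆ T := fun m hm => Relation.ReflTransGen.single
    ⟨hadj m hm, fun h => hout m hm (hforced h), fun h => hin m hm (hforced h)⟩
  have hmoral : ∀ G ∈ F, G.IsMoralOn T := by
    intro G hG a ha b hb c hc hab hcb hac
    by_contra hn
    exact hD₀.not_compelled_of_mem ha hb (.vstructure ((hv G hG a b c).1 ⟨hac, hab, hcb, hn⟩))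
  have hclt : G₀.skeleton.IsClique (insert t M) :=
    hcl.insert fun m hm _ => hadj m hm
  obtain ⟨g, hg, hgt⟩ := exists_isAdmissible_lt ⟨G₀, hG₀⟩ hD hs hclt
    (fun h => (hadj t h).ne rfl) hout _ T rfl hmoral htT hMT
  have hdirT : ∀ {x y}, (redirect hD₀ t g).dir x y → ¬ (x ∈ T ∧ y ∈ T) → G₀.dir x y := by
    rintro x y (h | h) hn
    · exact absurd ⟨h.1, h.2.1⟩ hn
    · exact h.2
  have hforced' : ∀ {x y}, Forced F x y → (redirect hD₀ t g).dir x y := by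
    intro x y h
    by_cases hxy : x ∈ T ∧ y ∈ T
    · exact Or.inl ⟨hxy.1, hxy.2, adj_of_dir (h G₀ hG₀),
        hg.lt_of_forced x hxy.1 y hxy.2 h⟩
    · exact Or.inr ⟨hxy, h G₀ hG₀⟩
  have hdag : (redirect hD₀ t g).IsDAG := fun _ _ => id
  have hskel : (redirect hD₀ t g).skeleton = G₀.skeleton := by
    ext x y
    constructor
    · intro h
      rcases hdag.adj_iff.1 h with (h | h) | (h | h)
      · exact h.2.2.1
      · exact adj_of_dir h.2
      · exact h.2.2.1.symm
      · exact (adj_of_dir h.2).symm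
    · intro h
      rw [hdag.adj_iff]
      by_cases hxy : x ∈ T ∧ y ∈ T
      · rcases lt_or_gt_of_ne (hg.ne_of_adj x hxy.1 y hxy.2 h) with hlt | hlt
        · exact Or.inl (Or.inl ⟨hxy.1, hxy.2, h, hlt⟩)
        · exact Or.inr (Or.inl ⟨hxy.2, hxy.1, h.symm, hlt⟩)
      · rcases hD₀.adj_iff.1 h with h | h
        · exact Or.inl (Or.inr ⟨hxy, h⟩)
        · exact Or.inr (Or.inr ⟨fun h => hxy h.symm, h⟩)
  -- An outside parent of one vertex of `T` is a parent of all, so a new v-structure cannot mix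
  -- outside and inside parents.
  have houter : ∀ {x z y}, x ∉ T → y ∈ T → z ∈ T → (redirect hD₀ t g).dir x z →
      G₀.skeleton.Adj x y := by
    intro x z y hx hy hz hxz
    have hxz' := hdirT hxz fun h => hx h.1
    rcases compelled_or_of_notMem hz hx (adj_of_dir hxz').symm with h | h
    · exact absurd (h.dir hD₀ rfl fun _ _ _ => Iff.rfl) (dir_asymm hxz')
    · exact adj_of_dir ((h.of_mem_chainComponent hz hy).dir hD₀ rfl fun _ _ _ => Iff.rfl)
  refine ⟨redirect hD₀ t g, hdag, hskel, fun x z y => ⟨?_, ?_⟩, fun x y => hforced', ?_⟩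
  · rintro ⟨hxy, hxz, hyz, hn⟩
    rw [hskel] at hn
    by_cases hz : z ∈ T
    · by_cases hx : x ∈ T
      · by_cases hy : y ∈ T
        · rcases hxz with hxz | hxz
          · rcases hyz with hyz | hyz
            · exact absurd (hg.moral x hx z hz y hy hxz.2.2.1 hyz.2.2.1 hxz.2.2.2 hyz.2.2.2 hxy) hn
            · exact absurd ⟨hy, hz⟩ hyz.1
          · exact absurd ⟨hx, hz⟩ hxz.1
        · exact absurd (houter hy hx hz hyz).symm hn
      · by_cases hy : y ∈ T
        · exact absurd (houter hx hy hz hxz) hn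
        · exact ⟨hxy, hdirT hxz fun h => hx h.1, hdirT hyz fun h => hy h.1, hn⟩
    · exact ⟨hxy, hdirT hxz fun h => hz h.2, hdirT hyz fun h => hz h.2, hn⟩
  · intro h
    exact ⟨h.1, hforced' (hforced (.vstructure h)), hforced' (hforced (.vstructure h.symm)),
      hskel ▸ h.2.2.2⟩
  · exact fun m hm => Or.inl ⟨hMT hm, htT, (hadj m hm).symm, hgt m hm⟩

/-! ### Fully informative MPDAGs -/

section MPDAG

variable {C H : PDAG V} {K : Set (DCC V)}

theorem IsMPDAGOf.dir_of_dir (hH : H.IsMPDAGOf C K) {x y : V} (h : C.dir x y) : H.dir x y :=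
  (hH.2.2 x y).2 fun G hG => (hG.1.2.2 x y).1 h G hG.1.1 (.refl G)

theorem IsMPDAGOf.restrictedClass_subset (hH : H.IsMPDAGOf C K) :
    C.restrictedClass K ⊆ H.orientations := fun G hG =>
  ⟨hG.1.1, fun x y h => (hH.2.2 x y).1 h G hG, hG.1.2.1.symm.trans hH.1.symm,
    (hG.1.2.sameVStructures hG.1.1).symm.trans hH.2.1.symm⟩

theorem IsMPDAGOf.mem_markovClass [Finite V] (hC : C.IsCPDAG) (hH : H.IsMPDAGOf C K) {G : PDAG V}
    (hG : G ∈ H.orientations) : G ∈ C.markovClass :=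
  hC.mem_markovClass_iff.2 ⟨hG.1, hG.2.2.1.trans hH.1, hG.2.2.2.trans hH.2.1⟩

/-- A clause whose heads contain two nonadjacent siblings of its tail holds for every DAG with the
same skeleton and v-structures. -/
theorem holdsFor_of_not_isClique {P G : PDAG V} (hG : G.IsDAG) (hs : G.skeleton = P.skeleton)
    (hv : G.SameVStructures P) {κ : DCC V}
    (h : ¬ P.skeleton.IsClique (κ.heads ∩ P.sib κ.tail)) : κ.HoldsFor G := by
  by_contra hno
  refine h fun a ha b hb hab => ?_
  by_contra hn
  have hdir : ∀ a ∈ κ.heads ∩ P.sib κ.tail, G.dir a κ.tail := fun a ha =>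
    (hG.adj_iff.1 (hs ▸ Or.inr (Or.inr ha.2) : G.skeleton.Adj κ.tail a)).resolve_left fun h' =>
      hno ⟨a, ha.1, h'⟩
  have := (hv a κ.tail b).1 ⟨hab, hdir a ha, hdir b hb, hs ▸ hn⟩
  exact P.dir_not_und _ _ this.2.1 (P.und_symm _ _ ha.2)

theorem IsMPDAGOf.fullyInformative_of_forall [Finite V] (hC : C.IsCPDAG) (hH : H.IsMPDAGOf C K)
    (h : ∀ G ∈ H.orientations, ∀ κ ∈ K, κ.HoldsFor G) : H.FullyInformative C K :=
  Set.Subset.antisymm (fun G hG => ⟨hH.mem_markovClass hC hG, h G hG⟩) hH.restrictedClass_subset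

/-- With the restricted class as the family, forced edges are the directed edges of `H`. If no head
were a child, directing all sibling heads into the tail would give a member of `[H]` violating the
clause. -/
theorem IsMPDAGOf.nonempty_of_isClique [Finite V] (hK : C.Consistent K) (hH : H.IsMPDAGOf C K)
    (hfull : H.FullyInformative C K) {κ : DCC V} (hκ : κ ∈ K)
    (hcl : H.skeleton.IsClique (κ.heads ∩ H.sib κ.tail)) :
    (κ.heads ∩ H.ch κ.tail).Nonempty := by
  by_contra hch
  obtain ⟨G₀, hG₀⟩ := hK
  have hO := hH.restrictedClass_subset
  have hs₀ := (hO hG₀).2.2.1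
  have hv₀ := (hO hG₀).2.2.2
  obtain ⟨G, hG, hs, hv, hdir, hM⟩ := exists_forall_dir hG₀ (fun G hG => (hO hG).1)
    (fun G hG => (hO hG).2.2.1.trans hs₀.symm) (fun G hG => (hO hG).2.2.2.trans hv₀.symm)
    (M := κ.heads ∩ H.sib κ.tail) (t := κ.tail) (hs₀ ▸ hcl)
    (fun m hm => hs₀ ▸ Or.inr (Or.inr hm.2))
    (fun m hm h => H.dir_not_und _ _ ((hH.2.2 _ _).2 h) hm.2)
    (fun m hm h => H.dir_not_und _ _ ((hH.2.2 _ _).2 h) (H.und_symm _ _ hm.2))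
  have hmem : G ∈ H.orientations :=
    ⟨hG, fun x y h => hdir x y ((hH.2.2 x y).1 h), hs.trans hs₀, hv.trans hv₀⟩
  rw [hfull] at hmem
  obtain ⟨h, hh, hth⟩ := hmem.2 κ hκ
  have hadj : H.skeleton.Adj κ.tail h := hs₀ ▸ hs ▸ adj_of_dir hth
  rcases hadj with h' | h' | h'
  · exact hch ⟨h, hh, h'⟩
  · exact dir_asymm hth (hdir _ _ ((hH.2.2 _ _).1 h'))
  · exact dir_asymm hth (hM h ⟨hh, h'⟩)

end MPDAG

end PDAG

/-! ### The two criteria. -/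

theorem mainTheorem8 {V : Type*} [Finite V] (C : PDAG V) (hC : C.IsCPDAG)
    (K : Set (DCC V)) (hK : C.Consistent K) (H : PDAG V) (hH : H.IsMPDAGOf C K) :
    (H.FullyInformative C K ↔
      ∀ κ ∈ K, ¬ H.skeleton.IsClique (κ.heads ∩ H.sib κ.tail) ∨
        (κ.heads ∩ H.ch κ.tail).Nonempty) ∧
    (H.FullyInformative C K ↔
      ∀ κ ∈ C.completeReducedForm K, (κ.heads ∩ H.ch κ.tail).Nonempty) := by
  refine ⟨⟨fun hfull κ hκ => ?_, fun h => ?_⟩, ⟨?_, fun h => ?_⟩⟩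
  · by_cases hcl : H.skeleton.IsClique (κ.heads ∩ H.sib κ.tail)
    · exact Or.inr (hH.nonempty_of_isClique hK hfull hκ hcl)
    · exact Or.inl hcl
  · refine hH.fullyInformative_of_forall hC fun G hG κ hκ => ?_
    rcases h κ hκ with hcl | ⟨x, hx, htx⟩
    · exact PDAG.holdsFor_of_not_isClique hG.1 hG.2.2.1 hG.2.2.2 hcl
    · exact ⟨x, hx, hG.2.1 _ _ htx⟩
  · rintro hfull κ' ⟨⟨κ, hκ, hch, rfl⟩, hcl⟩
    -- Directed edges of `C` persist in `H`, so siblings in `H` are siblings in `C` and the clique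
    -- condition passes to `H`.
    have hsub : κ.heads ∩ H.sib κ.tail ⊆ κ.heads ∩ C.sib κ.tail := by
      rintro x ⟨hx, htx⟩
      refine ⟨hx, ?_⟩
      have hadj : C.skeleton.Adj κ.tail x := hH.1 ▸ Or.inr (Or.inr htx)
      rcases hadj with h | h | h
      · exact absurd htx (H.dir_not_und _ _ (hH.dir_of_dir h))
      · exact absurd (H.und_symm _ _ htx) (H.dir_not_und _ _ (hH.dir_of_dir h))
      · exact h
    obtain ⟨x, hx, htx⟩ := hH.nonempty_of_isClique hK hfull hκ (hH.1 ▸ hcl.subset hsub)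
    refine ⟨x, ⟨hx, ?_⟩, htx⟩
    have hadj : C.skeleton.Adj κ.tail x := hH.1 ▸ Or.inl htx
    rcases hadj with h | h | h
    · exact absurd (show x ∈ κ.heads ∩ C.ch κ.tail from ⟨hx, h⟩) (hch ▸ Set.notMem_empty x)
    · exact absurd (hH.dir_of_dir h) (PDAG.dir_asymm htx)
    · exact h
  · refine hH.fullyInformative_of_forall hC fun G hG κ hκ => ?_
    by_cases hch : κ.heads ∩ C.ch κ.tail = ∅
    · by_cases hcl : C.skeleton.IsClique (κ.heads ∩ C.sib κ.tail)
      · obtain ⟨x, hx, htx⟩ := h (κ.restrictHeads (C.sib κ.tail)) ⟨⟨κ, hκ, hch, rfl⟩, hcl⟩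
        exact ⟨x, hx.1, hG.2.1 _ _ htx⟩
      · exact PDAG.holdsFor_of_not_isClique hG.1 (hG.2.2.1.trans hH.1) (hG.2.2.2.trans hH.2.1) hcl
    · obtain ⟨x, hx, htx⟩ := Set.nonempty_iff_ne_empty.2 hch
      exact ⟨x, hx, hG.2.1 _ _ (hH.dir_of_dir htx)⟩
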